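/- Let $r\ge 0$, $s\ge 1$, $N$ be integers, and let $\mu_1,\dots,\mu_s,\nu_1,\dots,\nu_r$ be non-negative integers; put $\nu_0:=0$. For parameters such that a vertical line separates the poles of the functions $\Gamma(b_j-u)$, $j\le m$ (on its right) from those of the functions $\Gamma(1-a_j+u)$, $j\le n$ (on its left), let $$G^{m,n}_{p,q}\Big(z\,\Big|\,{a_1,\dots,a_p\atop b_1,\dots,b_q}\Big)=\frac1{2\pi i}\int_{c-i\infty}^{c+i\infty}\frac{\prod_{j=1}^m\Gamma(b_j-u)\prod_{j=1}^n\Gamma(1-a_j+u)}{\prod_{j=m+1}^q\Gamma(1-b_j+u)\prod_{j=n+1}^p\Gamma(a_j-u)}\,z^u\,du$$ denote the Meijer $G$-function, where $\operatorname{Re}u=c$ is any such line. For $j=1,\dots,N$ and $x>0$ put $$I_j(x)=G^{r,s}_{s,r}\Big(x\,\Big|\,{-(\mu_1+j-1+N),-(\mu_2+N),\dots,-(\mu_s+N)\atop \nu_1,\dots,\nu_r}\Big),$$ and consider the density on $(0,\infty)^N$ proportional to $$\prod_{1\le j<k\le N}(x_k-x_j)\;\det\big[I_j(x_k)\big]_{j,k=1,\dots,N}.$$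 For $0\le l,n\le N-1$ define $$C_l=(-1)^l\prod_{j=0}^r\Gamma(\nu_j+l+1)\prod_{p=1}^s\Gamma(\mu_p+N-l),\qquad Q_l(x)=\frac{(-1)^l}{C_l}\,G^{r+1,s}_{s+1,r+1}\Big(x\,\Big|\,{-(\mu_1+N),\dots,-(\mu_s+N),-l\atop \nu_0,\nu_1,\dots,\nu_r}\Big),$$ $$P_n(x)=(-1)^n\prod_{j=1}^r\frac{\Gamma(\nu_j+n+1)}{\Gamma(\nu_j+1)}\prod_{l=1}^s\frac{\Gamma(\mu_l+N-n)}{\Gamma(\mu_l+N)}\;{}_{s+1}F_r\Big({-n,1-\mu_1-N,\dots,1-\mu_s-N\atop 1+\nu_1,\dots,1+\nu_r}\,\Big|\,(-1)^s x\Big).$$ Then all these contour integrals converge absolutely, and $(P_n),(Q_l)$ is the unique biorthogonal system of the ensemble: $P_n$ is a monic polynomial of degree $n$, $Q_l$ is on $(0,\infty)$ a linear combination of $I_1,\dots,I_{l+1}$, and $$\int_0^\infty P_n(x)Q_l(x)\,dx=\delta_{n,l}\qquad(0\le n,l\le N-1).$$ Moreover the weight above is integrable on $(0,\infty)^N$ with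 non-zero integral, and with $K_N(x,y)=\sum_{l=0}^{N-1}P_l(x)Q_l(y)$ the $k$-point correlation functions of the normalized density (that is, $\frac{N!}{(N-k)!}$ times the integral of the density over the last $N-k$ variables) are $\rho_{(k)}(x_1,\dots,x_k)=\det[K_N(x_i,x_j)]_{i,j=1,\dots,k}$ for $0\le k\le N$ and $x_1,\dots,x_k>0$. -/

import Mathlib

open scoped BigOperators

/-- The quotient of Gamma functions in the integrand of the Meijer function `G^{m,n}_{p,q}`
with upper parameters `a_1, …, a_p` and lower parameters `b_1, …, b_q` (indexed from `0` here).
At a pole of a Gamma function in the denominator, Mathlib's value `Gamma = 0`, `1 / 0 = 0`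
agrees with the value `0` of the entire function `1 / Gamma`. -/
noncomputable def meijerKernel (m n : ℕ) {p q : ℕ} (a : Fin p → ℂ) (b : Fin q → ℂ) (u : ℂ) : ℂ :=
  ((∏ j : Fin q with j.val < m, Complex.Gamma (b j - u)) *
      (∏ j : Fin p with j.val < n, Complex.Gamma (1 - a j + u))) /
    ((∏ j : Fin q with m ≤ j.val, Complex.Gamma (1 - b j + u)) *
      (∏ j : Fin p with n ≤ j.val, Complex.Gamma (a j - u)))

/-- The vertical line `Re u = c` separates the poles of `Γ(b_j - u)`, `j ≤ m` (on its right) from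
the poles of `Γ(1 - a_j + u)`, `j ≤ n` (on its left). -/
def SeparatesPoles (c : ℝ) (m n : ℕ) {p q : ℕ} (a : Fin p → ℂ) (b : Fin q → ℂ) : Prop :=
  (∀ j : Fin q, j.val < m → c < (b j).re) ∧ (∀ j : Fin p, j.val < n → (a j).re - 1 < c)

/-- The Meijer function `G^{m,n}_{p,q}(z | a; b)`, with contour the upwards oriented vertical line
`Re u = c`: `(1 / 2πi) ∫_{c - i∞}^{c + i∞} (…) z^u du`. -/
noncomputable def meijerG (c : ℝ) (m n : ℕ) {p q : ℕ} (a : Fin p → ℂ) (b : Fin q → ℂ) (z : ℂ) : ℂ :=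
  (1 / (2 * (Real.pi : ℂ) * Complex.I)) *
    ∫ t : ℝ, meijerKernel m n a b (c + t * Complex.I) * z ^ ((c : ℂ) + t * Complex.I) * Complex.I

/-- The generalized hypergeometric series `{}_pF_q(a; b | x)`, with
`(c)_k = c (c+1) ⋯ (c+k-1)`. -/
noncomputable def hypergeomPFQ {p q : ℕ} (a : Fin p → ℂ) (b : Fin q → ℂ) (x : ℂ) : ℂ :=
  ∑' k : ℕ, ((∏ i, (ascPochhammer ℂ k).eval (a i)) / (∏ i, (ascPochhammer ℂ k).eval (b i))) *
    (x ^ k / (k.factorial : ℂ))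

/-! ### Ensembles `∏_{j<k} (x_k - x_j) det [φ_j(x_k)]` on `(0,∞)^N` -/

/-- The open positive orthant. -/
def posOrthant (n : ℕ) : Set (Fin n → ℝ) := {y | ∀ i, 0 < y i}

/-- The weight `∏_{j<k} (x_k - x_j) · det [φ_j(x_k)]_{j,k}`. -/
noncomputable def ensembleWeight {N : ℕ} (φ : Fin N → ℝ → ℂ) (x : Fin N → ℝ) : ℂ :=
  (∏ j : Fin N, ∏ k ∈ Finset.Ioi j, ((x k : ℂ) - (x j : ℂ))) *
    (Matrix.of fun j k : Fin N => φ j (x k)).det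

/-- The point of `ℝ^N` whose first `k` coordinates are `x` and whose other ones are `y`. -/
def joinCoords {N k : ℕ} (x : Fin k → ℝ) (y : Fin (N - k) → ℝ) : Fin N → ℝ := fun i =>
  if h : i.val < k then x ⟨i.val, h⟩ else y ⟨i.val - k, by have := i.isLt; omega⟩

/-- The `k`-point correlation function
`ρ_k(x_1, …, x_k) = N! / (N-k)! ∫_{(0,∞)^{N-k}} p(x_1, …, x_N) dx_{k+1} ⋯ dx_N`
of the normalized density `p = w / ∫ w` on `(0,∞)^N`. -/
noncomputable def correlationFunction {N : ℕ} (w : (Fin N → ℝ) → ℂ) (k : ℕ) (x : Fin k → ℝ) : ℂ :=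
  ((N.factorial : ℂ) / ((N - k).factorial : ℂ)) *
    ∫ y in posOrthant (N - k), w (joinCoords x y) / ∫ z in posOrthant N, w z

/-- `(P_n), (Q_l)`, `0 ≤ n, l ≤ N-1`, is a biorthogonal system on `(0,∞)` for the ensemble with
functions `φ_0, …, φ_{N-1}`: `P_n` is a monic polynomial of degree `n`, `Q_l` is in the linear
span of `φ_0, …, φ_l`, and `∫_0^∞ P_n Q_l dx = δ_{n,l}` (with convergent integral). -/
structure IsBiorthogonalSystem {N : ℕ} (φ : Fin N → ℝ → ℂ) (P Q : Fin N → ℝ → ℂ) : Prop where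
  monic : ∀ n : Fin N, ∃ p : Polynomial ℂ, p.Monic ∧ p.natDegree = n.val ∧
    ∀ x : ℝ, P n x = p.eval (x : ℂ)
  span : ∀ l : Fin N, ∃ d : Fin N → ℂ, ∀ x : ℝ, 0 < x →
    Q l x = ∑ j ∈ Finset.Iic l, d j * φ j x
  integrable : ∀ n l : Fin N,
    MeasureTheory.IntegrableOn (fun x : ℝ => P n x * Q l x) (Set.Ioi 0)
  biorthogonal : ∀ n l : Fin N,
    ∫ x in Set.Ioi (0 : ℝ), P n x * Q l x = if n = l then 1 else 0

/-- The kernel `K_N(x, y) = ∑_{l=0}^{N-1} P_l(x) Q_l(y)`. -/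
noncomputable def biorthogonalKernel {N : ℕ} (P Q : Fin N → ℝ → ℂ) (x y : ℝ) : ℂ :=
  ∑ l : Fin N, P l x * Q l y

/-! ### The objects attached to the product of `r` Gaussian and `s` inverse Gaussian matrices

The lists `μ_1, …, μ_s` and `ν_1, …, ν_r` are indexed from `0`; row `j` of the determinant and
the index `j : Fin N` here are related by `row = j + 1`. -/

/-- Upper parameters `-(μ_1 + j + N), -(μ_2 + N), …, -(μ_s + N)` of the functions in the
determinant; `j = 0, …, N-1`. -/
def weightUpper (N : ℕ) {s : ℕ} (μ : Fin s → ℕ) (j : ℕ) : Fin s → ℂ := fun i =>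
  if i.val = 0 then -((μ i : ℂ) + j + N) else -((μ i : ℂ) + N)

/-- Lower parameters `ν_1, …, ν_r`. -/
def weightLower {r : ℕ} (ν : Fin r → ℕ) : Fin r → ℂ := fun i => (ν i : ℂ)

/-- Upper parameters `-(μ_1 + N), …, -(μ_s + N), -l`. -/
def dualUpper (N : ℕ) {s : ℕ} (μ : Fin s → ℕ) (l : ℕ) : Fin (s + 1) → ℂ :=
  Fin.snoc (α := fun _ => ℂ) (fun i : Fin s => -((μ i : ℂ) + N)) (-(l : ℂ))

/-- The list `ν_0, ν_1, …, ν_r` with `ν_0 = 0`. -/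
def extendedNu {r : ℕ} (ν : Fin r → ℕ) : Fin (r + 1) → ℕ :=
  Fin.cons (α := fun _ => ℕ) 0 ν

/-- Lower parameters `ν_0, ν_1, …, ν_r`. -/
def dualLower {r : ℕ} (ν : Fin r → ℕ) : Fin (r + 1) → ℂ := fun i => (extendedNu ν i : ℂ)

/-- Entry function `G^{r,s}_{s,r}(x | -(μ_1+j+N), -(μ_2+N), …, -(μ_s+N); ν_1, …, ν_r)` of the
determinant, with contour `Re u = c`. -/
noncomputable def weightFun (N : ℕ) {r s : ℕ} (μ : Fin s → ℕ) (ν : Fin r → ℕ) (c : ℝ) (j : ℕ)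
    (x : ℝ) : ℂ :=
  meijerG c r s (weightUpper N μ j) (weightLower ν) (x : ℂ)

/-- `C_l = (-1)^l ∏_{j=0}^r Γ(ν_j + l + 1) ∏_{p=1}^s Γ(μ_p + N - l)`. -/
noncomputable def constC (N : ℕ) {r s : ℕ} (μ : Fin s → ℕ) (ν : Fin r → ℕ) (l : ℕ) : ℂ :=
  (-1) ^ l * (∏ j : Fin (r + 1), Complex.Gamma ((extendedNu ν j : ℂ) + l + 1)) *
    ∏ i : Fin s, Complex.Gamma ((μ i : ℂ) + N - l)

/-- `Q_l(x) = ((-1)^l / C_l) G^{r+1,s}_{s+1,r+1}(x | -(μ_1+N), …, -(μ_s+N), -l; ν_0, …, ν_r)`,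
with contour `Re u = c`. -/
noncomputable def dualFun (N : ℕ) {r s : ℕ} (μ : Fin s → ℕ) (ν : Fin r → ℕ) (c : ℝ) (l : ℕ)
    (x : ℝ) : ℂ :=
  ((-1) ^ l / constC N μ ν l) * meijerG c (r + 1) s (dualUpper N μ l) (dualLower ν) (x : ℂ)

/-- `P_n(x) = (-1)^n ∏_j Γ(ν_j+n+1)/Γ(ν_j+1) ∏_l Γ(μ_l+N-n)/Γ(μ_l+N) ·
{}_{s+1}F_r(-n, 1-μ_1-N, …, 1-μ_s-N; 1+ν_1, …, 1+ν_r | (-1)^s x)`. -/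
noncomputable def polyFun (N : ℕ) {r s : ℕ} (μ : Fin s → ℕ) (ν : Fin r → ℕ) (n : ℕ)
    (x : ℝ) : ℂ :=
  (-1) ^ n *
    (∏ j : Fin r, Complex.Gamma ((ν j : ℂ) + n + 1) / Complex.Gamma ((ν j : ℂ) + 1)) *
    (∏ i : Fin s, Complex.Gamma ((μ i : ℂ) + N - n) / Complex.Gamma ((μ i : ℂ) + N)) *
    hypergeomPFQ (Fin.cons (α := fun _ => ℂ) (-(n : ℂ)) (fun i : Fin s => 1 - (μ i : ℂ) - N))
      (fun j : Fin r => 1 + (ν j : ℂ)) ((-1) ^ s * (x : ℂ))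

/-! Every Meijer function in the statement has an integrand of one shape: a polynomial `p(u)` times
the fixed product `∏ Γ(ν_j - u) ∏ Γ(1 + μ_i + N + u)`. With rows counted from `0`, raising the first
upper shift by `j` contributes a Pochhammer polynomial of degree `j` (`gammaKernel_upperShift`). For
`Q_l` the quotient `Γ(-u) / Γ(-l - u)` is a polynomial of degree `l` (`meijerKernel_dual`). Since
the shifted Pochhammer polynomials are monic, one in each degree, the span condition is an expansion
of polynomials (`exists_eq_sum_of_monic`).

By Mellin inversion (`StripDecay.moment`) the `k`-th moment of such a function is its integrand at
`u = -k - 1`, that is `p(-k-1) M_k` with `M_k` the `momentConst`. For `Q_l` this is `k(k-1)⋯(k-l+1)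
M_k / (l! M_l)`, while `P_n` has coefficients `(-1)^(n+k) (n choose k) M_n / M_k` (`polyFun_eq`).
The `M_k` cancel, and biorthogonality is the alternating binomial sum
`sum_alternating_choose_mul_descFactorial`.

The rest is linear algebra, valid for any biorthogonal system whose weight functions have finite
moments. Biorthogonality triangularly factorizes the inverse of the moment matrix, which gives
uniqueness. The weight is a non-zero multiple of `det P · det Q` (`ensembleWeight_eq`), and
integrating out variables yields the kernel determinant (`integral_det_mul_det`). -/

/-! ### Contour shifts and Mellin inversion for functions decaying on a strip. -/

section StripTransform

open Complex Set MeasureTheory Filter Topology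
open scoped FourierTransform

/-- `F` is holomorphic on the closed vertical strip `c₁ ≤ Re u ≤ c₂` and is `O(1 / (1 + (Im u)²))`
there. -/
structure StripDecay (F : ℂ → ℂ) (c₁ c₂ : ℝ) : Prop where
  differentiableOn : DifferentiableOn ℂ F {u | u.re ∈ Icc c₁ c₂}
  bound : ∃ C : ℝ, ∀ u : ℂ, u.re ∈ Icc c₁ c₂ → ‖F u‖ ≤ C * (1 + u.im ^ 2)⁻¹

/-- `(1 / 2πi) ∫ F(u) x^u du` along the upwards oriented line `Re u = c`. -/
noncomputable def lineTransform (F : ℂ → ℂ) (c : ℝ) (x : ℝ) : ℂ :=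
  (1 / (2 * (Real.pi : ℂ) * I)) * ∫ t : ℝ, F (c + t * I) * (x : ℂ) ^ ((c : ℂ) + t * I) * I

namespace StripDecay

variable {F : ℂ → ℂ} {c₁ c₂ c : ℝ}

theorem mono (h : StripDecay F c₁ c₂) {d₁ d₂ : ℝ} (h₁ : c₁ ≤ d₁) (h₂ : d₂ ≤ c₂) :
    StripDecay F d₁ d₂ := by
  have hs : ∀ u : ℂ, u.re ∈ Icc d₁ d₂ → u.re ∈ Icc c₁ c₂ := fun u hu =>
    ⟨h₁.trans hu.1, hu.2.trans h₂⟩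
  obtain ⟨C, hC⟩ := h.bound
  exact ⟨h.differentiableOn.mono hs, C, fun u hu => hC u (hs u hu)⟩

theorem continuous_line (h : StripDecay F c₁ c₂) (hc : c ∈ Icc c₁ c₂) :
    Continuous fun t : ℝ => F (c + t * I) :=
  h.differentiableOn.continuousOn.comp_continuous (by fun_prop) fun t => by simpa using hc

theorem integrable_line (h : StripDecay F c₁ c₂) (hc : c ∈ Icc c₁ c₂) :
    Integrable fun t : ℝ => F (c + t * I) := by
  obtain ⟨C, hC⟩ := h.bound
  refine (integrable_inv_one_add_sq.const_mul C).mono' (h.continuous_line hc).aestronglyMeasurable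
    (ae_of_all _ fun t => ?_)
  simpa using hC (c + t * I) (by simpa using hc)

/-- Cauchy's theorem on the rectangle of height `2T`; the horizontal sides are `O(1 / T²)` and
disappear as `T → ∞`. -/
theorem integral_line_eq (h : StripDecay F c₁ c₂) (hc : c₁ ≤ c₂) :
    ∫ t : ℝ, F (c₁ + t * I) = ∫ t : ℝ, F (c₂ + t * I) := by
  obtain ⟨C, hC⟩ := h.bound
  have hlim : ∀ c ∈ Icc c₁ c₂, Tendsto (fun T : ℝ => ∫ t in (-T)..T, F (c + t * I)) atTop
      (𝓝 (∫ t : ℝ, F (c + t * I))) := fun c hc =>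
    intervalIntegral_tendsto_integral (h.integrable_line hc) tendsto_neg_atTop_atBot tendsto_id
  have hdec : Tendsto (fun T : ℝ => C * (1 + T ^ 2)⁻¹ * |c₂ - c₁|) atTop (𝓝 0) := by
    have h1 : Tendsto (fun T : ℝ => 1 + T ^ 2) atTop atTop :=
      tendsto_atTop_add_const_left _ _ (tendsto_pow_atTop two_ne_zero)
    simpa using (h1.inv_tendsto_atTop.const_mul C).mul_const |c₂ - c₁|
  have hhor : ∀ S T : ℝ, S ^ 2 = T ^ 2 →
      ‖∫ x in c₁..c₂, F (x + S * I)‖ ≤ C * (1 + T ^ 2)⁻¹ * |c₂ - c₁| := fun S T hST => by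
    refine intervalIntegral.norm_integral_le_of_norm_le_const fun x hx => ?_
    rw [uIoc_of_le hc] at hx
    have := hC (x + S * I) (by simpa using ⟨hx.1.le, hx.2⟩)
    simpa [hST] using this
  have hz : ∀ S : ℝ → ℝ, (∀ T, S T ^ 2 = T ^ 2) →
      Tendsto (fun T : ℝ => ∫ x in c₁..c₂, F (x + S T * I)) atTop (𝓝 0) := fun S hS =>
    squeeze_zero_norm (fun T => hhor (S T) T (hS T)) hdec
  have hrect : ∀ T : ℝ, (∫ x in c₁..c₂, F (x + (-T : ℝ) * I)) - (∫ x in c₁..c₂, F (x + T * I)) +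
      I * (∫ t in (-T)..T, F (c₂ + t * I)) - I * (∫ t in (-T)..T, F (c₁ + t * I)) = 0 := by
    intro T
    have := Complex.integral_boundary_rect_eq_zero_of_differentiableOn F ⟨c₁, -T⟩ ⟨c₂, T⟩
      (h.differentiableOn.mono fun u hu => by
        have := hu.1
        rwa [mem_preimage, uIcc_of_le hc] at this)
    simpa using this
  have hall := (((hz (fun T => -T) (by simp)).sub (hz (fun T => T) (by simp))).add
    ((hlim c₂ ⟨hc, le_rfl⟩).const_mul I)).sub ((hlim c₁ ⟨le_rfl, hc⟩).const_mul I)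
  have h0 := tendsto_nhds_unique (hall.congr hrect) tendsto_const_nhds
  have h1 : I * ((∫ t : ℝ, F (c₁ + t * I)) - ∫ t : ℝ, F (c₂ + t * I)) = 0 := by
    linear_combination -h0
  exact sub_eq_zero.1 ((mul_eq_zero.1 h1).resolve_left I_ne_zero)

theorem mul_cpow (h : StripDecay F c₁ c₂) {x : ℝ} (hx : 0 < x) :
    StripDecay (fun u => F u * (x : ℂ) ^ u) c₁ c₂ := by
  have hx0 : (x : ℂ) ≠ 0 := by exact_mod_cast hx.ne'
  refine ⟨h.differentiableOn.mul fun u _ =>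
    (differentiableAt_id.const_cpow (Or.inl hx0)).differentiableWithinAt, ?_⟩
  obtain ⟨C, hC⟩ := h.bound
  refine ⟨C * (x ^ c₁ + x ^ c₂), fun u hu => ?_⟩
  rw [norm_mul, norm_cpow_eq_rpow_re_of_pos hx]
  -- The power is monotone in its exponent, in a direction depending on whether `x ≥ 1`, so one of
  -- the two endpoint values dominates.
  have hle : x ^ u.re ≤ x ^ c₁ + x ^ c₂ := by
    rcases le_total 1 x with h1 | h1
    · have := Real.rpow_le_rpow_of_exponent_le h1 hu.2
      have := Real.rpow_pos_of_pos hx c₁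
      linarith
    · have := Real.rpow_le_rpow_of_exponent_ge hx h1 hu.1
      have := Real.rpow_pos_of_pos hx c₂
      linarith
  have := mul_le_mul (hC u hu) hle (Real.rpow_nonneg hx.le _) ((norm_nonneg _).trans (hC u hu))
  linarith

theorem lineTransform_eq (h : StripDecay F c₁ c₂) (hc : c₁ ≤ c₂) {x : ℝ} (hx : 0 < x) :
    lineTransform F c₁ x = lineTransform F c₂ x := by
  unfold lineTransform
  rw [integral_mul_const, integral_mul_const, (h.mul_cpow hx).integral_line_eq hc]

end StripDecay

/-- On the line, `|x^u| = x^c`. No integrability is needed, since a divergent integral has the value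
`0`. -/
theorem exists_norm_lineTransform_le (F : ℂ → ℂ) (c : ℝ) :
    ∃ C : ℝ, ∀ x : ℝ, 0 < x → ‖lineTransform F c x‖ ≤ C * x ^ c := by
  refine ⟨‖(1 / (2 * (Real.pi : ℂ) * I))‖ * ∫ t : ℝ, ‖F (c + t * I)‖, fun x hx => ?_⟩
  unfold lineTransform
  rw [norm_mul, mul_assoc ‖_‖, ← integral_mul_const]
  gcongr
  refine (norm_integral_le_integral_norm _).trans (le_of_eq ?_)
  congr 1
  ext t
  rw [norm_mul, norm_mul, norm_cpow_eq_rpow_re_of_pos hx]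
  simp

theorem lineTransform_eq_mellinInv (F : ℂ → ℂ) (c : ℝ) (x : ℝ) :
    lineTransform F c x = mellinInv (-c) (fun u => F (-u)) x := by
  unfold lineTransform mellinInv
  rw [integral_mul_const, ← integral_neg_eq_self]
  have hI : (I : ℂ) ≠ 0 := I_ne_zero
  have hpi : (Real.pi : ℂ) ≠ 0 := by exact_mod_cast Real.pi_ne_zero
  rw [Complex.real_smul]
  push_cast
  rw [show ∀ A B : ℂ, 1 / (2 * (Real.pi : ℂ) * I) * (A * I) = 1 / (2 * (Real.pi : ℂ)) * A by
    intro A B; field_simp]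
  · congr 2
    ext t
    rw [smul_eq_mul, mul_comm]
    congr 2 <;> ring_nf
  -- The variable `B` of the rewriting identity above plays no role, so any value will do.
  · exact 0

/-- In the logarithmic variable `x = e^(-u)` the line integral is an inverse Fourier transform, so
that Fourier theory applies. -/
theorem lineTransform_exp_neg {F : ℂ → ℂ} {c : ℝ} (u : ℝ) :
    (Real.exp (c * u) : ℂ) * lineTransform F c (Real.exp (-u)) =
      𝓕⁻ (fun y : ℝ => F (c + (-(2 * Real.pi) * y : ℝ) * I)) u := by
  rw [lineTransform_eq_mellinInv, mellinInv_eq_fourierInv _ _ (Real.exp_pos _), Real.log_exp,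
    neg_neg, smul_eq_mul, ← mul_assoc]
  have : (Real.exp (c * u) : ℂ) * (Real.exp (-u) : ℂ) ^ (-((-c : ℝ) : ℂ)) = 1 := by
    rw [← ofReal_neg, ← ofReal_cpow (Real.exp_pos _).le, ← Real.exp_mul, ← ofReal_mul,
      ← Real.exp_add]
    simp [mul_comm]
  rw [this, one_mul]
  refine congrArg (fun g : ℝ → ℂ => 𝓕⁻ g u) (funext fun y => congrArg F ?_)
  push_cast
  ring

namespace StripDecay

variable {F : ℂ → ℂ} {c₁ c₂ c : ℝ}

theorem continuousOn_lineTransform (h : StripDecay F c₁ c₂) (hc : c ∈ Icc c₁ c₂) :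
    ContinuousOn (lineTransform F c) (Ioi 0) := by
  have hi : Integrable fun y : ℝ => F (c + (-(2 * Real.pi) * y : ℝ) * I) :=
    (h.integrable_line hc).comp_mul_left' (by simp [Real.pi_ne_zero])
  have hcont : Continuous (𝓕⁻ (fun y : ℝ => F (c + (-(2 * Real.pi) * y : ℝ) * I))) :=
    VectorFourier.fourierIntegral_continuous Real.continuous_fourierChar
      (by fun_prop) hi
  have heq : ∀ x ∈ Ioi (0 : ℝ), lineTransform F c x =
      (Real.exp (c * Real.log x) : ℂ) *
        𝓕⁻ (fun y : ℝ => F (c + (-(2 * Real.pi) * y : ℝ) * I)) (-Real.log x) := by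
    intro x hx
    rw [← lineTransform_exp_neg, neg_neg, Real.exp_log hx, ← mul_assoc, ← ofReal_mul,
      ← Real.exp_add]
    simp
  refine ContinuousOn.congr ?_ heq
  have hlog : ContinuousOn Real.log (Ioi 0) := Real.continuousOn_log.mono fun x hx => hx.ne'
  exact (continuous_ofReal.comp_continuousOn
    (Real.continuous_exp.comp_continuousOn (hlog.const_mul c))).mul
    (hcont.comp_continuousOn hlog.neg)

/-- Shifting the contour to `c₁` controls the function at infinity and shifting it to `c₂` controls
it at `0`; the strict inequalities make both ends integrable. -/
theorem mellinConvergent (h : StripDecay F c₁ c₂) (h₁ : c₁ < c) (h₂ : c < c₂) :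
    MellinConvergent (lineTransform F c) (-c : ℝ) := by
  have hc : c ∈ Icc c₁ c₂ := ⟨h₁.le, h₂.le⟩
  obtain ⟨C₁, hC₁⟩ := exists_norm_lineTransform_le F c₁
  obtain ⟨C₂, hC₂⟩ := exists_norm_lineTransform_le F c₂
  have e₁ : ∀ x : ℝ, 0 < x → lineTransform F c x = lineTransform F c₁ x := fun x hx =>
    ((h.mono le_rfl h₂.le).lineTransform_eq h₁.le hx).symm
  have e₂ : ∀ x : ℝ, 0 < x → lineTransform F c x = lineTransform F c₂ x := fun x hx =>
    (h.mono h₁.le le_rfl).lineTransform_eq h₂.le hx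
  refine mellinConvergent_of_isBigO_rpow (a := -c₁) (b := -c₂)
    ((h.continuousOn_lineTransform hc).locallyIntegrableOn measurableSet_Ioi) ?_ ?_ ?_ ?_
  · refine Asymptotics.IsBigO.of_bound C₁ ?_
    filter_upwards [eventually_gt_atTop 0] with x hx
    rw [e₁ x hx, neg_neg, Real.norm_of_nonneg (Real.rpow_nonneg hx.le _)]
    exact hC₁ x hx
  · simpa using h₁
  · refine Asymptotics.IsBigO.of_bound C₂ ?_
    filter_upwards [self_mem_nhdsWithin] with x hx
    rw [e₂ x hx, neg_neg, Real.norm_of_nonneg (Real.rpow_nonneg (le_of_lt hx) _)]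
    exact hC₂ x hx
  · simpa using h₂

theorem integrable_fourierInv (h : StripDecay F c₁ c₂) (h₁ : c₁ < c) (h₂ : c < c₂) :
    Integrable (𝓕⁻ (fun y : ℝ => F (c + (-(2 * Real.pi) * y : ℝ) * I))) := by
  have hconv := h.mellinConvergent h₁ h₂
  have himg : (Ioi (0 : ℝ)) = (fun u : ℝ => Real.exp (-u)) '' univ := by
    rw [image_univ]
    ext x
    refine ⟨fun hx => ⟨-Real.log x, by simp [Real.exp_log hx]⟩, ?_⟩
    rintro ⟨u, rfl⟩
    exact Real.exp_pos _
  rw [MellinConvergent, himg, integrableOn_image_iff_integrableOn_abs_deriv_smul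
    (f' := fun u => -Real.exp (-u)) MeasurableSet.univ
    (fun u _ => by
      have := (Real.hasDerivAt_exp (-u)).comp u (hasDerivAt_neg u)
      rw [mul_neg_one] at this
      exact this.hasDerivWithinAt)
    (fun u _ v _ huv => neg_injective (Real.exp_injective huv)), integrableOn_univ] at hconv
  refine hconv.congr (ae_of_all _ fun u => ?_)
  dsimp only
  rw [← lineTransform_exp_neg, abs_neg, abs_of_pos (Real.exp_pos _), Complex.real_smul, smul_eq_mul,
    ← mul_assoc, ← ofReal_one, ← ofReal_sub, ← ofReal_cpow (Real.exp_pos _).le, ← Real.exp_mul,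
    ← ofReal_mul, ← Real.exp_add]
  congr 3
  ring

/-- Fourier inversion evaluated at frequency `0`. The integrability of the transform that it
requires is Mellin convergence after the substitution `x = e^(-u)`. -/
theorem mellin_lineTransform (h : StripDecay F c₁ c₂) (h₁ : c₁ < c) (h₂ : c < c₂) :
    mellin (lineTransform F c) (-c : ℝ) = F c := by
  have hc : c ∈ Icc c₁ c₂ := ⟨h₁.le, h₂.le⟩
  have hi : Integrable fun y : ℝ => F (c + (-(2 * Real.pi) * y : ℝ) * I) :=
    (h.integrable_line hc).comp_mul_left' (by simp [Real.pi_ne_zero])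
  have hcont : Continuous fun y : ℝ => F (c + (-(2 * Real.pi) * y : ℝ) * I) :=
    (h.continuous_line hc).comp (continuous_const.mul continuous_id)
  rw [mellin_eq_fourier]
  have : (fun u : ℝ => Real.exp (-((-c : ℝ) : ℂ).re * u) • lineTransform F c (Real.exp (-u))) =
      𝓕⁻ (fun y : ℝ => F (c + (-(2 * Real.pi) * y : ℝ) * I)) := by
    ext u
    rw [← lineTransform_exp_neg, Complex.real_smul]
    simp
  have hint := h.integrable_fourierInv h₁ h₂
  have hint' : Integrable (𝓕 (fun y : ℝ => F (c + (-(2 * Real.pi) * y : ℝ) * I))) := by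
    have := hint.comp_neg
    refine this.congr (ae_of_all _ fun u => ?_)
    simp [Real.fourierInv_eq_fourier_neg]
  rw [this, hcont.fourier_fourierInv_eq hi hint']
  simp

/-- The moments of the inverse transform of `F` are the values of `F` at negative integers. -/
theorem moment (h : StripDecay F c₁ c₂) (hc : c ∈ Icc c₁ c₂) {k : ℕ}
    (h₁ : c₁ < -(k : ℝ) - 1) (h₂ : -(k : ℝ) - 1 < c₂) :
    IntegrableOn (fun x : ℝ => (x : ℂ) ^ k * lineTransform F c x) (Ioi 0) ∧
      ∫ x in Ioi (0 : ℝ), (x : ℂ) ^ k * lineTransform F c x = F (-(k : ℂ) - 1) := by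
  have hpow : ∀ x ∈ Ioi (0 : ℝ), (x : ℂ) ^ (((-(-(k : ℝ) - 1) : ℝ) : ℂ) - 1) •
      lineTransform F (-(k : ℝ) - 1) x = (x : ℂ) ^ k * lineTransform F c x := by
    intro x hx
    have : lineTransform F (-(k : ℝ) - 1) x = lineTransform F c x := by
      rcases le_total c (-(k : ℝ) - 1) with hle | hle
      · exact ((h.mono hc.1 h₂.le).lineTransform_eq hle hx).symm
      · exact (h.mono h₁.le hc.2).lineTransform_eq hle hx
    rw [this, smul_eq_mul]
    congr 1
    rw [← Complex.cpow_natCast]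
    congr 1
    push_cast
    ring
  constructor
  · exact (h.mellinConvergent h₁ h₂).congr_fun hpow measurableSet_Ioi
  · have := h.mellin_lineTransform h₁ h₂
    rw [mellin, setIntegral_congr_fun measurableSet_Ioi hpow] at this
    rw [this]
    push_cast
    rfl

end StripDecay

end StripTransform

/-! ### Decay of products of Gamma functions on vertical strips. -/

section GammaKernel

open Complex Set MeasureTheory Polynomial

theorem norm_Gamma_le_Gamma_re {z : ℂ} (hz : 0 < z.re) : ‖Gamma z‖ ≤ Real.Gamma z.re := by
  rw [Gamma_eq_integral hz, Real.Gamma_eq_integral hz, GammaIntegral]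
  refine (norm_integral_le_integral_norm _).trans (le_of_eq ?_)
  refine setIntegral_congr_fun measurableSet_Ioi fun x hx => ?_
  rw [norm_mul, norm_cpow_eq_rpow_re_of_pos hx, Complex.norm_of_nonneg (Real.exp_pos _).le]
  simp

/-- The Gamma function decays faster than any power on vertical strips of the right half plane. -/
theorem exists_norm_Gamma_mul_pow_le (k : ℕ) {α : ℝ} (β : ℝ) (hα : 0 < α) :
    ∃ C : ℝ, ∀ z : ℂ, z.re ∈ Icc α β → ‖Gamma z‖ * (1 + |z.im|) ^ k ≤ C := by
  induction k generalizing α β with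
  | zero =>
    have hcont : ContinuousOn Real.Gamma (Icc α β) := fun x hx =>
      (Real.differentiableAt_Gamma fun m => by
        have : (0 : ℝ) ≤ m := m.cast_nonneg
        have := hx.1
        intro h
        linarith).continuousAt.continuousWithinAt
    obtain ⟨C, hC⟩ := isCompact_Icc.bddAbove_image hcont
    refine ⟨C, fun z hz => ?_⟩
    rw [pow_zero, mul_one]
    exact (norm_Gamma_le_Gamma_re (hα.trans_le hz.1)).trans (hC (mem_image_of_mem _ hz))
  | succ k ih =>
    -- Since `Γ(z) = Γ(z+1) / z`, passing to the strip moved right by `1` gains one power of `|z|`.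
    obtain ⟨C, hC⟩ := ih (β + 1) (show 0 < α + 1 by linarith)
    refine ⟨(1 + α⁻¹) * C, fun z hz => ?_⟩
    have hz0 : z ≠ 0 := by
      rintro rfl
      exact (hα.trans_le hz.1).ne' rfl
    have h1 := hC (z + 1) (by simpa using hz)
    rw [Gamma_add_one z hz0, norm_mul] at h1
    have him : (z + 1).im = z.im := by simp
    rw [him] at h1
    have hα' : α ≤ ‖z‖ := hz.1.trans (re_le_norm z)
    have h2 : 1 + |z.im| ≤ (1 + α⁻¹) * ‖z‖ := by
      have := abs_im_le_norm z
      have h3 : 1 ≤ α⁻¹ * ‖z‖ := by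
        rw [inv_mul_eq_div, one_le_div hα]
        exact hα'
      linarith
    calc ‖Gamma z‖ * (1 + |z.im|) ^ (k + 1)
        = (1 + |z.im|) * (‖Gamma z‖ * (1 + |z.im|) ^ k) := by ring
      _ ≤ ((1 + α⁻¹) * ‖z‖) * (‖Gamma z‖ * (1 + |z.im|) ^ k) := by gcongr
      _ = (1 + α⁻¹) * (‖z‖ * ‖Gamma z‖ * (1 + |z.im|) ^ k) := by ring
      _ ≤ (1 + α⁻¹) * C := by gcongr

theorem exists_norm_eval_le (p : ℂ[X]) (c₁ c₂ : ℝ) :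
    ∃ C : ℝ, ∃ d : ℕ, ∀ u : ℂ, u.re ∈ Icc c₁ c₂ → ‖p.eval u‖ ≤ C * (1 + |u.im|) ^ d := by
  have hu : ∀ u : ℂ, u.re ∈ Icc c₁ c₂ → ‖u‖ ≤ (1 + |c₁| + |c₂|) * (1 + |u.im|) := fun u hu => by
    have h1 := norm_le_abs_re_add_abs_im u
    have h2 : |u.re| ≤ |c₁| + |c₂| := abs_le.2
      ⟨by linarith [hu.1, neg_abs_le c₁, abs_nonneg c₂],
        by linarith [hu.2, le_abs_self c₂, abs_nonneg c₁]⟩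
    have h3 : 0 ≤ (|c₁| + |c₂|) * |u.im| := by positivity
    linarith
  refine ⟨∑ i ∈ Finset.range (p.natDegree + 1), ‖p.coeff i‖ * (1 + |c₁| + |c₂|) ^ i,
    p.natDegree, fun u h => ?_⟩
  rw [eval_eq_sum_range, Finset.sum_mul]
  refine (norm_sum_le _ _).trans (Finset.sum_le_sum fun i hi => ?_)
  rw [norm_mul, norm_pow, mul_assoc]
  gcongr
  refine (pow_le_pow_left₀ (norm_nonneg _) (hu u h) i).trans ?_
  rw [mul_pow]
  gcongr
  · linarith [abs_nonneg u.im]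
  · exact Nat.lt_succ_iff.1 (Finset.mem_range.1 hi)

variable {ι κ : Type*} [Fintype ι] [Fintype κ]

/-- `p(u) ∏_j Γ(b_j - u) ∏_i Γ(a_i + u)`. -/
noncomputable def gammaKernel (a : ι → ℝ) (b : κ → ℝ) (p : ℂ[X]) (u : ℂ) : ℂ :=
  p.eval u * ((∏ j, Gamma (b j - u)) * ∏ i, Gamma (a i + u))

theorem exists_norm_prod_le (σ : ι → ℂ → ℂ) (S : Set ℂ)
    (h : ∀ i, ∃ C : ℝ, ∀ u ∈ S, ‖σ i u‖ ≤ C) : ∃ C : ℝ, ∀ u ∈ S, ‖∏ i, σ i u‖ ≤ C := by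
  choose C hC using h
  refine ⟨∏ i, C i, fun u hu => ?_⟩
  rw [norm_prod]
  exact Finset.prod_le_prod (fun _ _ => norm_nonneg _) fun i _ => hC i u hu

theorem differentiableAt_Gamma_of_re_pos {z : ℂ} (hz : 0 < z.re) : DifferentiableAt ℂ Gamma z :=
  differentiableAt_Gamma z fun m h => by
    rw [h] at hz
    simp only [neg_re, natCast_re] at hz
    linarith [(m.cast_nonneg : (0 : ℝ) ≤ m)]

/-- A single factor `Γ(a_i + u)` beats the polynomial, and all other Gamma factors are bounded. This
is where `s ≥ 1` enters the analysis. -/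
theorem stripDecay_gammaKernel [Nonempty ι] (a : ι → ℝ) (b : κ → ℝ) (p : ℂ[X]) {c₁ c₂ : ℝ}
    (ha : ∀ i, -a i < c₁) (hb : ∀ j, c₂ < b j) : StripDecay (gammaKernel a b p) c₁ c₂ := by
  classical
  constructor
  · intro u hu
    refine DifferentiableAt.differentiableWithinAt ?_
    refine p.differentiable.differentiableAt.mul (DifferentiableAt.mul ?_ ?_)
    · refine DifferentiableAt.fun_finsetProd fun j _ => ?_
      refine (differentiableAt_Gamma_of_re_pos ?_).comp u (differentiableAt_id.const_sub _)
      simpa using hu.2.trans_lt (hb j)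
    · refine DifferentiableAt.fun_finsetProd fun i _ => ?_
      refine (differentiableAt_Gamma_of_re_pos ?_).comp u (differentiableAt_id.const_add _)
      have := (ha i).trans_le hu.1
      simp only [add_re, ofReal_re]
      linarith
  · obtain ⟨C₀, d, h₀⟩ := exists_norm_eval_le p c₁ c₂
    have hΓa : ∀ (k : ℕ) (i : ι), ∃ C : ℝ, ∀ u ∈ {u : ℂ | u.re ∈ Icc c₁ c₂},
        ‖Gamma (a i + u)‖ * (1 + |u.im|) ^ k ≤ C := fun k i => by
      obtain ⟨C, hC⟩ := exists_norm_Gamma_mul_pow_le k (a i + c₂)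
        (show 0 < a i + c₁ by linarith [ha i])
      exact ⟨C, fun u hu => by simpa using hC (a i + u) (by simpa using hu)⟩
    obtain ⟨C₁, h₁⟩ := exists_norm_prod_le (fun j u => Gamma (b j - u))
      {u : ℂ | u.re ∈ Icc c₁ c₂} fun j => by
        obtain ⟨C, hC⟩ := exists_norm_Gamma_mul_pow_le 0 (b j - c₁)
          (show 0 < b j - c₂ by linarith [hb j])
        exact ⟨C, fun u hu => by simpa using hC (b j - u) ⟨by simp; linarith [hu.2], by simp; linarith [hu.1]⟩⟩
    obtain ⟨i₀⟩ := ‹Nonempty ι›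
    -- The whole power is charged to the factor `i₀`: `d` to absorb the polynomial and `2` for the
    -- quadratic decay.
    obtain ⟨C₂, h₂⟩ := exists_norm_prod_le (fun i u => Gamma (a i + u) *
      ((1 + |u.im| : ℝ) : ℂ) ^ (if i = i₀ then d + 2 else 0)) {u : ℂ | u.re ∈ Icc c₁ c₂}
      fun i => by
        obtain ⟨C, hC⟩ := hΓa (if i = i₀ then d + 2 else 0) i
        refine ⟨C, fun u hu => ?_⟩
        rw [norm_mul, norm_pow, Complex.norm_of_nonneg (by positivity)]
        exact hC u hu
    refine ⟨C₀ * (C₁ * C₂), fun u hu => ?_⟩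
    have e₀ := h₀ u hu
    have e₁ := h₁ u hu
    have e₂ := h₂ u hu
    rw [Finset.prod_mul_distrib, Finset.prod_pow_eq_pow_sum, norm_mul, norm_pow,
      Complex.norm_of_nonneg (show (0 : ℝ) ≤ 1 + |u.im| by positivity)] at e₂
    simp only [Finset.sum_ite_eq', Finset.mem_univ, if_true] at e₂
    set y := 1 + |u.im| with hy
    have hy1 : 1 ≤ y := by simp [hy]
    have hy0 : 0 < y := by linarith
    have hy2 : 1 + u.im ^ 2 ≤ y ^ 2 := by
      rw [hy, ← sq_abs u.im]
      nlinarith [abs_nonneg u.im]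
    have hC₀ : 0 ≤ C₀ := by
      by_contra hneg
      have := (norm_nonneg _).trans e₀
      have := mul_neg_of_neg_of_pos (not_le.1 hneg) (pow_pos hy0 d)
      linarith
    have hC₁ : 0 ≤ C₁ := (norm_nonneg _).trans e₁
    rw [← div_eq_mul_inv, le_div_iff₀ (by positivity)]
    unfold gammaKernel
    rw [norm_mul, norm_mul]
    calc ‖p.eval u‖ * (‖∏ j, Gamma (b j - u)‖ * ‖∏ i, Gamma (a i + u)‖) * (1 + u.im ^ 2)
        ≤ (C₀ * y ^ d) * (C₁ * ‖∏ i, Gamma (a i + u)‖) * y ^ 2 := by gcongr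
      _ = C₀ * (C₁ * (‖∏ i, Gamma (a i + u)‖ * y ^ (d + 2))) := by ring
      _ ≤ C₀ * (C₁ * C₂) := by gcongr

theorem gammaKernel_sum {σ : Type*} (a : ι → ℝ) (b : κ → ℝ) (s : Finset σ) (d : σ → ℂ)
    (p : σ → ℂ[X]) (u : ℂ) : gammaKernel a b (∑ j ∈ s, C (d j) * p j) u =
      ∑ j ∈ s, d j * gammaKernel a b (p j) u := by
  simp [gammaKernel, eval_finsetSum, Finset.sum_mul, mul_assoc]

theorem lineTransform_gammaKernel_sum [Nonempty ι] {σ : Type*} (a : ι → ℝ) (b : κ → ℝ)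
    (s : Finset σ) (d : σ → ℂ) (p : σ → ℂ[X]) {c : ℝ} (ha : ∀ i, -a i < c) (hb : ∀ j, c < b j)
    {x : ℝ} (hx : 0 < x) :
    lineTransform (gammaKernel a b (∑ j ∈ s, C (d j) * p j)) c x =
      ∑ j ∈ s, d j * lineTransform (gammaKernel a b (p j)) c x := by
  unfold lineTransform
  simp_rw [gammaKernel_sum, Finset.sum_mul, mul_assoc]
  rw [integral_finsetSum]
  · rw [Finset.mul_sum]
    refine Finset.sum_congr rfl fun j _ => ?_
    rw [integral_const_mul]
    ring
  · intro j _
    have h := (((stripDecay_gammaKernel a b (p j) ha hb).mul_cpow hx).integrable_line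
      ⟨le_rfl, le_rfl⟩).mul_const I
    simpa [mul_assoc] using h.const_mul (d j)

end GammaKernel

/-! ### Determinant expansions and integration of products of determinants. -/

section Determinants

open MeasureTheory Equiv Matrix

variable {κ η : Type*} [Fintype κ] [Fintype η] [DecidableEq κ] [DecidableEq η]

/-- The permutations extending `f` form a left coset of the copy of `Perm η` that fixes `κ`
pointwise. -/
theorem card_perm_comp_inl_eq {f : κ → κ ⊕ η} (hf : Function.Injective f) :
    (Finset.univ.filter fun σ : Perm (κ ⊕ η) => σ ∘ Sum.inl = f).card =
      (Fintype.card η).factorial := by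
  obtain ⟨σ₀, hσ₀⟩ : ∃ σ₀ : Perm (κ ⊕ η), σ₀ ∘ Sum.inl = f := by
    let g : Set.range (Sum.inl : κ → κ ⊕ η) ↪ κ ⊕ η :=
      ((Equiv.ofInjective _ Sum.inl_injective).symm.toEmbedding).trans ⟨f, hf⟩
    refine ⟨(g.toEquivRange).extendSubtype, funext fun i => ?_⟩
    have := (g.toEquivRange).extendSubtype_apply_of_mem (Sum.inl i) ⟨i, rfl⟩
    rw [Function.comp_apply, this, Function.Embedding.toEquivRange_apply]
    change f ((Equiv.ofInjective _ Sum.inl_injective).symm ⟨Sum.inl i, _⟩) = f i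
    rw [Equiv.ofInjective_symm_apply]
  rw [← Fintype.card_perm, ← Finset.card_univ]
  symm
  refine Finset.card_bij (fun τ _ => σ₀ * Perm.sumCongr 1 τ) ?_ ?_ ?_
  · intro τ _
    simp only [Finset.mem_filter, Finset.mem_univ, true_and]
    rw [← hσ₀]
    ext i
    simp
  · intro τ _ τ' _ h
    ext i
    have := Equiv.congr_fun (mul_left_cancel h) (Sum.inr i)
    simpa using this
  · intro σ hσ
    simp only [Finset.mem_filter, Finset.mem_univ, true_and] at hσ
    have hfix : ∀ i, (σ₀⁻¹ * σ) (Sum.inl i) = Sum.inl i := fun i => by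
      have := congrFun (hσ.trans hσ₀.symm) i
      simp only [Function.comp_apply] at this
      simp [this]
    obtain ⟨⟨τ₁, τ⟩, hτ⟩ := Perm.mem_sumCongrHom_range_of_perm_mapsTo_inl (σ := σ₀⁻¹ * σ) (by
      rintro _ ⟨i, rfl⟩
      exact ⟨i, (hfix i).symm⟩)
    refine ⟨τ, Finset.mem_univ _, ?_⟩
    have h1 : τ₁ = 1 := by
      ext i
      have := hfix i
      rw [← hτ] at this
      simpa using this
    subst h1
    rw [Perm.sumCongrHom_apply] at hτ
    simp only at hτ
    rw [hτ, mul_inv_cancel_left]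

theorem sum_perm_comp_inl (F : (κ → κ ⊕ η) → ℂ) (hF : ∀ f, ¬Function.Injective f → F f = 0) :
    ∑ σ : Perm (κ ⊕ η), F (σ ∘ Sum.inl) = (Fintype.card η).factorial * ∑ f, F f := by
  rw [← Finset.sum_fiberwise Finset.univ (fun σ : Perm (κ ⊕ η) => (σ ∘ Sum.inl : κ → κ ⊕ η)),
    Finset.mul_sum]
  refine Finset.sum_congr rfl fun f _ => ?_
  rw [Finset.sum_congr rfl fun σ hσ => congrArg F (Finset.mem_filter.1 hσ).2, Finset.sum_const,
    nsmul_eq_mul]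
  by_cases hf : Function.Injective f
  · rw [card_perm_comp_inl_eq hf]
  · rw [hF f hf, mul_zero, mul_zero]

/-- Only `det A` is expanded; its sign is absorbed by permuting the columns of `B` and its factors
by scaling the rows. If row `i` of `A` and `B` depends on the variable `x_i` alone, so does row `i`
of each summand, and the variables can be integrated row by row. -/
theorem det_mul_det_eq_sum {ι : Type*} [Fintype ι] [DecidableEq ι] (A B : Matrix ι ι ℂ) :
    A.det * B.det = ∑ σ : Perm ι, (Matrix.of fun i j => A i (σ i) * B i (σ j)).det := by
  rw [← det_transpose A, det_apply', Finset.sum_mul]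
  refine Finset.sum_congr rfl fun σ _ => ?_
  have := det_mul_column (fun i => A i (σ i)) (B.submatrix id σ)
  rw [det_permute'] at this
  simp only [submatrix_apply, id_eq] at this
  rw [this]
  simp only [transpose_apply]
  ring

/-- The Cauchy–Binet expansion of a kernel determinant. -/
theorem det_sum_mul_eq_sum {ι : Type*} [Fintype ι] [DecidableEq ι] (P Q : ι → κ → ℂ) :
    (Matrix.of fun i j => ∑ l, P l i * Q l j).det =
      ∑ f : κ → ι, (Matrix.of fun i j => P (f i) i * Q (f j) i).det := by
  rw [← det_transpose, det_apply']
  have h : ∀ f : κ → ι, (Matrix.of fun i j => P (f i) i * Q (f j) i).det =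
      ∑ τ : Perm κ, (Perm.sign τ : ℂ) * ∏ i, P (f i) i * Q (f i) (τ i) := fun f => by
    refine (det_mul_column (fun i => P (f i) i) (Matrix.of fun i j => Q (f j) i)).trans ?_
    rw [det_apply', Finset.mul_sum]
    refine Finset.sum_congr rfl fun τ _ => ?_
    simp only [of_apply, Finset.prod_mul_distrib]
    ring
  simp_rw [h]
  rw [Finset.sum_comm]
  refine Finset.sum_congr rfl fun τ _ => ?_
  rw [← Finset.mul_sum]
  congr 1
  simp only [transpose_apply, of_apply]
  rw [Finset.prod_univ_sum]
  simp

section Integrals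

variable {m : Measure ℝ} [SigmaFinite m]

theorem integrable_det_rows (A : κ → κ ⊕ η → ℂ) (h : η → κ ⊕ η → ℝ → ℂ)
    (hint : ∀ i j, Integrable (h i j) m) :
    Integrable (fun y : η → ℝ => (Matrix.of (Sum.elim A fun i j => h i j (y i))).det)
      (Measure.pi fun _ => m) := by
  simp_rw [← det_transpose (Matrix.of _), det_apply', transpose_apply, of_apply,
    Fintype.prod_sum_type, Sum.elim_inl, Sum.elim_inr]
  refine integrable_finsetSum _ fun σ _ => Integrable.const_mul (Integrable.const_mul ?_ _) _
  exact Integrable.fintype_prod fun i => hint i _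

/-- The integral of a determinant whose rows depend on separate variables. -/
theorem integral_det_rows (A : κ → κ ⊕ η → ℂ) (h : η → κ ⊕ η → ℝ → ℂ)
    (hint : ∀ i j, Integrable (h i j) m) :
    ∫ y : η → ℝ, (Matrix.of (Sum.elim A fun i j => h i j (y i))).det ∂(Measure.pi fun _ => m) =
      (Matrix.of (Sum.elim A fun i j => ∫ t, h i j t ∂m)).det := by
  simp_rw [← det_transpose (Matrix.of _), det_apply', transpose_apply, of_apply,
    Fintype.prod_sum_type, Sum.elim_inl, Sum.elim_inr]
  rw [integral_finsetSum]
  · refine Finset.sum_congr rfl fun σ _ => ?_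
    rw [integral_const_mul, integral_const_mul, integral_fintype_prod_eq_prod]
  · refine fun σ _ => Integrable.const_mul (Integrable.const_mul ?_ _) _
    exact Integrable.fintype_prod fun i => hint i _

variable (P Q : κ ⊕ η → ℝ → ℂ)

theorem det_mul_det_eq_sum_rows (x : κ → ℝ) (y : η → ℝ) :
    (Matrix.of fun i j => P j (Sum.elim x y i)).det *
        (Matrix.of fun i j => Q j (Sum.elim x y i)).det =
      ∑ σ : Perm (κ ⊕ η),
        (Matrix.of (Sum.elim (fun i j => P (σ (Sum.inl i)) (x i) * Q (σ j) (x i))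
          fun i j => P (σ (Sum.inr i)) (y i) * Q (σ j) (y i))).det := by
  rw [det_mul_det_eq_sum]
  refine Finset.sum_congr rfl fun σ _ => congrArg det ?_
  ext i j
  rcases i with i | i <;> simp

variable {P Q}

theorem integrable_det_mul_det (hint : ∀ i j, Integrable (fun t => P i t * Q j t) m) (x : κ → ℝ) :
    Integrable (fun y : η → ℝ => (Matrix.of fun i j => P j (Sum.elim x y i)).det *
        (Matrix.of fun i j => Q j (Sum.elim x y i)).det) (Measure.pi fun _ => m) := by
  simp_rw [det_mul_det_eq_sum_rows]
  exact integrable_finsetSum _ fun σ _ => integrable_det_rows _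
    (fun i j t => P (σ (Sum.inr i)) t * Q (σ j) t) fun i j => hint _ _

/-- Integrating out variables in a product of two determinants of biorthonormal functions. -/
theorem integral_det_mul_det (hint : ∀ i j, Integrable (fun t => P i t * Q j t) m)
    (hPQ : ∀ i j, ∫ t, P i t * Q j t ∂m = if i = j then 1 else 0) (x : κ → ℝ) :
    ∫ y : η → ℝ, (Matrix.of fun i j => P j (Sum.elim x y i)).det *
        (Matrix.of fun i j => Q j (Sum.elim x y i)).det ∂(Measure.pi fun _ => m) =
      (Fintype.card η).factorial * (Matrix.of fun i j => ∑ l, P l (x i) * Q l (x j)).det := by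
  simp_rw [det_mul_det_eq_sum_rows]
  rw [integral_finsetSum _ fun σ _ => integrable_det_rows _
    (fun i j t => P (σ (Sum.inr i)) t * Q (σ j) t) fun i j => hint _ _,
    det_sum_mul_eq_sum (fun l i => P l (x i)) fun l i => Q l (x i),
    ← sum_perm_comp_inl]
  · refine Finset.sum_congr rfl fun σ _ => ?_
    rw [integral_det_rows _ (fun i j t => P (σ (Sum.inr i)) t * Q (σ j) t) fun i j => hint _ _]
    simp_rw [hPQ]
    -- Biorthonormality turns the integrated rows into `(0, 1)`. What remains is the block of the
    -- fixed variables, which depends on `σ` only through `σ ∘ Sum.inl`.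
    have hblock := det_fromBlocks_zero₂₁
      (Matrix.of fun i j : κ => P (σ (Sum.inl i)) (x i) * Q (σ (Sum.inl j)) (x i))
      (Matrix.of fun (i : κ) (j : η) => P (σ (Sum.inl i)) (x i) * Q (σ (Sum.inr j)) (x i))
      (1 : Matrix η η ℂ)
    rw [det_one, mul_one] at hblock
    refine Eq.trans (congrArg det ?_) hblock
    ext i j
    rcases i with i | i <;> rcases j with j | j <;> simp [one_apply]
  -- A non-injective `f` gives two equal columns, so the sum over all `f` in the Cauchy–Binet
  -- expansion sees only injective ones.
  · intro f hf
    rw [Function.Injective] at hf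
    push Not at hf
    obtain ⟨i, j, hij, hne⟩ := hf
    refine (det_mul_column (fun i => P (f i) (x i)) (Matrix.of fun i j => Q (f j) (x i))).trans ?_
    rw [det_zero_of_column_eq hne (fun k => by simp [hij]), mul_zero]

end Integrals

end Determinants

/-! ### Uniqueness and correlation functions for a general biorthogonal system. -/

section Ensembles

open MeasureTheory Matrix Set

namespace IsBiorthogonalSystem

variable {N : ℕ} {φ P Q : Fin N → ℝ → ℂ}

/-- The lower triangular matrix expressing the dual functions through the weight functions. -/
theorem exists_lower (h : IsBiorthogonalSystem φ P Q) :
    ∃ D : Matrix (Fin N) (Fin N) ℂ, D.BlockTriangular OrderDual.toDual ∧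
      ∀ l, ∀ x : ℝ, 0 < x → Q l x = ∑ j, D l j * φ j x := by
  choose d hd using h.span
  refine ⟨Matrix.of fun l j => if j ≤ l then d l j else 0, fun i j hij => ?_, fun l x hx => ?_⟩
  · exact if_neg (not_le.2 (OrderDual.toDual_lt_toDual.1 hij))
  · rw [hd l x hx]
    simp only [of_apply, ite_mul, zero_mul]
    rw [← Finset.sum_filter]
    congr 1
    ext j
    simp

/-- The lower unitriangular matrix of coefficients of the polynomials. -/
theorem exists_coeff (h : IsBiorthogonalSystem φ P Q) :
    ∃ p : Matrix (Fin N) (Fin N) ℂ, p.BlockTriangular OrderDual.toDual ∧ (∀ n, p n n = 1) ∧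
      ∀ n, ∀ x : ℝ, P n x = ∑ k, p n k * (x : ℂ) ^ (k : ℕ) := by
  choose q hmonic hdeg heval using h.monic
  refine ⟨Matrix.of fun n k => (q n).coeff k, fun i j hij => ?_, fun n => ?_, fun n x => ?_⟩
  · refine Polynomial.coeff_eq_zero_of_natDegree_lt ?_
    rw [hdeg]
    exact OrderDual.toDual_lt_toDual.1 hij
  · have := hmonic n
    rw [Polynomial.Monic, Polynomial.leadingCoeff, hdeg] at this
    exact this
  · rw [heval, Polynomial.eval_eq_sum_range' (n := N) (by rw [hdeg]; exact n.isLt),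
      ← Fin.sum_univ_eq_sum_range fun k => (q n).coeff k * (x : ℂ) ^ k]
    rfl

theorem mul_gram_mul_eq_one (h : IsBiorthogonalSystem φ P Q)
    (hint : ∀ k j : Fin N, IntegrableOn (fun x : ℝ => (x : ℂ) ^ (k : ℕ) * φ j x) (Ioi 0))
    {D p : Matrix (Fin N) (Fin N) ℂ}
    (hD : ∀ l, ∀ x : ℝ, 0 < x → Q l x = ∑ j, D l j * φ j x)
    (hp : ∀ n, ∀ x : ℝ, P n x = ∑ k, p n k * (x : ℂ) ^ (k : ℕ)) :
    D * (Matrix.of fun j k : Fin N => ∫ x in Ioi (0 : ℝ), (x : ℂ) ^ (k : ℕ) * φ j x) * pᵀ = 1 := by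
  ext l n
  have hexp : ∀ x ∈ Ioi (0 : ℝ), P n x * Q l x =
      ∑ k, ∑ j, (p n k * D l j) * ((x : ℂ) ^ (k : ℕ) * φ j x) := fun x hx => by
    rw [hp, hD l x hx, Finset.sum_mul_sum]
    refine Finset.sum_congr rfl fun k _ => Finset.sum_congr rfl fun j _ => ?_
    ring
  have hb := h.biorthogonal n l
  rw [setIntegral_congr_fun measurableSet_Ioi hexp, integral_finsetSum _ fun k _ =>
    integrable_finsetSum _ fun j _ => (hint k j).const_mul _] at hb
  rw [one_apply, Matrix.mul_apply]
  simp_rw [eq_comm (a := l)]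
  rw [← hb]
  refine Finset.sum_congr rfl fun k _ => ?_
  rw [integral_finsetSum _ fun j _ => (hint k j).const_mul _, Matrix.mul_apply, Finset.sum_mul]
  refine Finset.sum_congr rfl fun j _ => ?_
  rw [integral_const_mul, transpose_apply, of_apply]
  ring

/-- With `G` the moment matrix, both systems satisfy `D G pᵀ = 1`, so `pᵀ D = G⁻¹ = p'ᵀ D'`. Then
`D' D⁻¹ = (p'ᵀ)⁻¹ pᵀ` is both lower and upper triangular, hence diagonal, and the unit diagonals of
`p` and `p'` force it to be `1`. -/
theorem unique (h : IsBiorthogonalSystem φ P Q)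
    (hint : ∀ k j : Fin N, IntegrableOn (fun x : ℝ => (x : ℂ) ^ (k : ℕ) * φ j x) (Ioi 0))
    {P' Q' : Fin N → ℝ → ℂ} (h' : IsBiorthogonalSystem φ P' Q') (n : Fin N) :
    (∀ x : ℝ, P' n x = P n x) ∧ (∀ x : ℝ, 0 < x → Q' n x = Q n x) := by
  obtain ⟨D, hDt, hD⟩ := h.exists_lower
  obtain ⟨p, hpt, hp1, hp⟩ := h.exists_coeff
  obtain ⟨D', hDt', hD'⟩ := h'.exists_lower
  obtain ⟨p', hpt', hp1', hp'⟩ := h'.exists_coeff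
  have e := h.mul_gram_mul_eq_one hint hD hp
  have e' := h'.mul_gram_mul_eq_one hint hD' hp'
  set G : Matrix (Fin N) (Fin N) ℂ :=
    Matrix.of fun j k : Fin N => ∫ x in Ioi (0 : ℝ), (x : ℂ) ^ (k : ℕ) * φ j x
  have e1 : pᵀ * D * G = 1 := by
    rw [Matrix.mul_assoc]
    exact mul_eq_one_comm.1 e
  have e1' : p'ᵀ * D' * G = 1 := by
    rw [Matrix.mul_assoc]
    exact mul_eq_one_comm.1 e'
  have e2 : p'ᵀ * D' = pᵀ * D := by
    rw [← Matrix.mul_one (p'ᵀ * D'), ← mul_eq_one_comm.1 e1, ← Matrix.mul_assoc, e1',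
      Matrix.one_mul]
  have : Invertible D := invertibleOfRightInverse D (G * pᵀ) (by rw [← Matrix.mul_assoc, e])
  have : Invertible p'ᵀ := invertibleOfLeftInverse p'ᵀ (D' * G) e'
  have hW1 : (D' * D⁻¹).BlockTriangular OrderDual.toDual :=
    hDt'.mul (blockTriangular_inv_of_blockTriangular hDt)
  have e3 : p'ᵀ * (D' * D⁻¹) = pᵀ := by
    rw [← Matrix.mul_assoc, e2, Matrix.mul_assoc, Matrix.mul_inv_of_invertible, Matrix.mul_one]
  have hpT : pᵀ.BlockTriangular id := fun i j hij => hpt (OrderDual.toDual_lt_toDual.2 hij)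
  have hpT' : p'ᵀ.BlockTriangular id := fun i j hij => hpt' (OrderDual.toDual_lt_toDual.2 hij)
  have e4 : D' * D⁻¹ = (p'ᵀ)⁻¹ * pᵀ := by
    rw [← e3, ← Matrix.mul_assoc, Matrix.inv_mul_of_invertible, Matrix.one_mul]
  have hW2 : (D' * D⁻¹).BlockTriangular id := by
    rw [e4]
    exact (blockTriangular_inv_of_blockTriangular hpT').mul hpT
  have hoff : ∀ i j, i ≠ j → (D' * D⁻¹) i j = 0 := fun i j hij => by
    rcases lt_or_gt_of_ne hij with hlt | hlt
    · exact hW1 (OrderDual.toDual_lt_toDual.2 hlt)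
    · exact hW2 hlt
  have hW : D' * D⁻¹ = 1 := by
    ext i j
    rw [one_apply]
    split_ifs with hij
    · subst hij
      have := congrFun (congrFun e3 i) i
      rw [Matrix.mul_apply, Finset.sum_eq_single i (fun k _ hk => by rw [hoff k i hk, mul_zero])
        (fun hi => absurd (Finset.mem_univ i) hi), transpose_apply, transpose_apply, hp1, hp1',
        one_mul] at this
      exact this
    · exact hoff i j hij
  have hDD : D' = D := by
    rw [← Matrix.mul_one D', ← Matrix.inv_mul_of_invertible D, ← Matrix.mul_assoc, hW,
      Matrix.one_mul]
  have hpp : p' = p := by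
    rw [hW, Matrix.mul_one] at e3
    exact transpose_injective e3
  subst hDD hpp
  exact ⟨fun x => by rw [hp, hp'], fun x hx => by rw [hD n x hx, hD' n x hx]⟩

/-- Replacing monomials by monic polynomials leaves the Vandermonde determinant unchanged, and
passing from `φ` to `Q` multiplies the other determinant by `det D`, which is non-zero because `D G
pᵀ = 1`. -/
theorem ensembleWeight_eq (h : IsBiorthogonalSystem φ P Q)
    (hint : ∀ k j : Fin N, IntegrableOn (fun x : ℝ => (x : ℂ) ^ (k : ℕ) * φ j x) (Ioi 0)) :
    ∃ c : ℂ, c ≠ 0 ∧ ∀ x : Fin N → ℝ, (∀ i, 0 < x i) →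
      ensembleWeight φ x = c * ((Matrix.of fun i j => P j (x i)).det *
        (Matrix.of fun i j => Q j (x i)).det) := by
  obtain ⟨D, hDt, hD⟩ := h.exists_lower
  obtain ⟨p, hpt, hp1, hp⟩ := h.exists_coeff
  have e := h.mul_gram_mul_eq_one hint hD hp
  have hdet : D.det ≠ 0 := by
    intro h0
    have := congrArg det e
    rw [det_mul, det_mul, h0, det_one, zero_mul, zero_mul] at this
    exact zero_ne_one this
  refine ⟨D.det⁻¹, inv_ne_zero hdet, fun x hx => ?_⟩
  have hQ : (Matrix.of fun i j => Q j (x i)).det =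
      D.det * (Matrix.of fun j k : Fin N => φ j (x k)).det := by
    rw [← det_mul, ← det_transpose]
    refine congrArg det ?_
    ext l k
    rw [transpose_apply, of_apply, hD l _ (hx k), Matrix.mul_apply]
    rfl
  have hP : ∏ j : Fin N, ∏ k ∈ Finset.Ioi j, ((x k : ℂ) - (x j : ℂ)) =
      (Matrix.of fun i j => P j (x i)).det := by
    choose q hmonic hdeg heval using h.monic
    rw [← det_vandermonde (fun i => (x i : ℂ)),
      det_eval_matrixOfPolynomials_eq_det_vandermonde _ q hdeg hmonic]
    simp_rw [heval]
  rw [ensembleWeight, hP, hQ]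
  field_simp

theorem volume_restrict_posOrthant (m : ℕ) :
    (volume : Measure (Fin m → ℝ)).restrict (posOrthant m) =
      Measure.pi fun _ => (volume : Measure ℝ).restrict (Ioi 0) := by
  rw [← Measure.restrict_pi_pi, ← volume_pi]
  congr 1
  ext y
  simp [posOrthant]

/-- An arbitrary splitting `e` of the indices covers the normalization (no fixed variables) and
every `k`-point function at once, with the same `c`, which cancels in the quotient. -/
theorem integrableOn_and_integral_ensembleWeight (h : IsBiorthogonalSystem φ P Q)
    (hint : ∀ k j : Fin N, IntegrableOn (fun x : ℝ => (x : ℂ) ^ (k : ℕ) * φ j x) (Ioi 0)) :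
    ∃ c : ℂ, c ≠ 0 ∧ ∀ (k m : ℕ) (e : Fin k ⊕ Fin m ≃ Fin N) (x : Fin k → ℝ), (∀ i, 0 < x i) →
      IntegrableOn (fun y => ensembleWeight φ (Sum.elim x y ∘ e.symm)) (posOrthant m) ∧
      ∫ y in posOrthant m, ensembleWeight φ (Sum.elim x y ∘ e.symm) =
        c * (m.factorial * (Matrix.of fun i j => biorthogonalKernel P Q (x i) (x j)).det) := by
  obtain ⟨c, hc, hw⟩ := h.ensembleWeight_eq hint
  refine ⟨c, hc, fun k m e x hx => ?_⟩
  have hms : MeasurableSet (posOrthant m) := by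
    have : posOrthant m = Set.pi univ fun _ => Ioi 0 := by
      ext y
      simp [posOrthant]
    rw [this]
    exact MeasurableSet.univ_pi fun _ => measurableSet_Ioi
  have hpt : ∀ y ∈ posOrthant m, ensembleWeight φ (Sum.elim x y ∘ e.symm) =
      c * ((Matrix.of fun i j => P (e j) (Sum.elim x y i)).det *
        (Matrix.of fun i j => Q (e j) (Sum.elim x y i)).det) := fun y hy => by
    rw [hw]
    · rw [← det_submatrix_equiv_self e (Matrix.of fun i j => P j ((Sum.elim x y ∘ e.symm) i)),
        ← det_submatrix_equiv_self e (Matrix.of fun i j => Q j ((Sum.elim x y ∘ e.symm) i))]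
      congr 3 <;> ext i j <;> simp
    · intro i
      rw [Function.comp_apply]
      rcases e.symm i with j | j
      · exact hx j
      · exact hy j
  have hI : ∀ i j, Integrable (fun t => P (e i) t * Q (e j) t) (volume.restrict (Ioi (0 : ℝ))) :=
    fun i j => h.integrable (e i) (e j)
  constructor
  · refine IntegrableOn.congr_fun ?_ (fun y hy => (hpt y hy).symm) hms
    rw [IntegrableOn, volume_restrict_posOrthant]
    exact (integrable_det_mul_det hI x).const_mul c
  · rw [setIntegral_congr_fun hms hpt, volume_restrict_posOrthant, integral_const_mul,
      integral_det_mul_det (P := fun i => P (e i)) (Q := fun i => Q (e i)) hI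
        (fun i j => by rw [h.biorthogonal]; simp) x, Fintype.card_fin]
    congr 4
    ext i j
    exact e.sum_comp fun l => P l (x i) * Q l (x j)

theorem integrableOn_ensembleWeight (h : IsBiorthogonalSystem φ P Q)
    (hint : ∀ k j : Fin N, IntegrableOn (fun x : ℝ => (x : ℂ) ^ (k : ℕ) * φ j x) (Ioi 0)) :
    IntegrableOn (ensembleWeight φ) (posOrthant N) ∧
      (∫ x in posOrthant N, ensembleWeight φ x) ≠ 0 ∧
      ∀ k : ℕ, k ≤ N → ∀ x : Fin k → ℝ, (∀ i, 0 < x i) →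
        correlationFunction (ensembleWeight φ) k x =
          (Matrix.of fun i j : Fin k => biorthogonalKernel P Q (x i) (x j)).det := by
  obtain ⟨c, hc, hw⟩ := h.integrableOn_and_integral_ensembleWeight hint
  obtain ⟨hi, hZ⟩ := hw 0 N (Equiv.emptySum (Fin 0) (Fin N)) Fin.elim0 fun i => i.elim0
  have hcoe : ∀ y : Fin N → ℝ,
      Sum.elim (Fin.elim0 : Fin 0 → ℝ) y ∘ (Equiv.emptySum (Fin 0) (Fin N)).symm = y := fun y => by
    ext i
    simp
  simp_rw [hcoe] at hi hZ
  rw [det_fin_zero, mul_one] at hZ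
  have hfac : ∀ m : ℕ, (m.factorial : ℂ) ≠ 0 := fun m => by
    exact_mod_cast m.factorial_ne_zero
  refine ⟨hi, by rw [hZ]; exact mul_ne_zero hc (hfac N), fun k hk x hx => ?_⟩
  have hwk := (hw k (N - k) (finSumFinEquiv.trans (finCongr (Nat.add_sub_of_le hk))) x hx).2
  have hjoin : ∀ y : Fin (N - k) → ℝ, Sum.elim x y ∘
      (finSumFinEquiv.trans (finCongr (Nat.add_sub_of_le hk))).symm = joinCoords x y := fun y => by
    rw [Equiv.comp_symm_eq]
    ext i
    rcases i with i | i <;> simp [joinCoords]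
  simp_rw [hjoin] at hwk
  rw [correlationFunction, integral_div, hwk, hZ]
  have := hfac N
  have := hfac (N - k)
  field_simp

end IsBiorthogonalSystem

end Ensembles

/-! ### Reduction of the Meijer kernels to a polynomial times a fixed Gamma product. -/

section ProductEnsemble

open Complex Set MeasureTheory Polynomial

theorem lineTransform_gammaKernel_congr {ι κ : Type*} [Fintype ι] [Fintype κ] [Nonempty ι]
    (a : ι → ℝ) (b : κ → ℝ) (p : ℂ[X]) {c c' : ℝ} (ha : ∀ i, -a i < c) (hb : ∀ j, c < b j)
    (ha' : ∀ i, -a i < c') (hb' : ∀ j, c' < b j) {x : ℝ} (hx : 0 < x) :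
    lineTransform (gammaKernel a b p) c x = lineTransform (gammaKernel a b p) c' x := by
  rcases le_total c c' with h | h
  · exact (stripDecay_gammaKernel a b p ha hb').lineTransform_eq h hx
  · exact ((stripDecay_gammaKernel a b p ha' hb).lineTransform_eq h hx).symm

theorem moment_gammaKernel {ι κ : Type*} [Fintype ι] [Fintype κ] [Nonempty ι]
    (a : ι → ℝ) (b : κ → ℝ) (p : ℂ[X]) {c : ℝ} (ha : ∀ i, -a i < c) (hb : ∀ j, c < b j) {k : ℕ}
    (ha' : ∀ i, (k : ℝ) + 2 ≤ a i) (hb' : ∀ j, 0 ≤ b j) :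
    IntegrableOn (fun x : ℝ => (x : ℂ) ^ k * lineTransform (gammaKernel a b p) c x) (Ioi 0) ∧
      ∫ x in Ioi (0 : ℝ), (x : ℂ) ^ k * lineTransform (gammaKernel a b p) c x =
        gammaKernel a b p (-(k : ℂ) - 1) := by
  have hk : (0 : ℝ) ≤ k := k.cast_nonneg
  -- The margin `1/2` on either side of `-k - 1` stays clear of the poles because `a i ≥ k + 2` and
  -- `b j ≥ 0`; `min` and `max` enlarge the strip to contain the given line.
  refine (stripDecay_gammaKernel a b p (c₁ := min c (-(k : ℝ) - 3 / 2))
    (c₂ := max c (-(k : ℝ) - 1 / 2)) (fun i => lt_min (ha i) ?_) (fun j => max_lt (hb j) ?_)).moment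
    ⟨min_le_left _ _, le_max_left _ _⟩ (min_lt_of_right_lt ?_) (lt_max_of_lt_right ?_)
  · linarith [ha' i]
  · linarith [hb' j]
  · linarith
  · linarith

variable {N r s : ℕ}

/-- The shifts `1 - a_i` for the upper parameters `a_i` of the weight functions. -/
def upperShift (N : ℕ) {s : ℕ} (μ : Fin s → ℕ) (j : ℕ) (i : Fin s) : ℝ :=
  1 + μ i + N + if i.val = 0 then (j : ℝ) else 0

theorem one_add_le_upperShift (μ : Fin s → ℕ) (j : ℕ) (i : Fin s) :
    1 + (N : ℝ) ≤ upperShift N μ j i := by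
  unfold upperShift
  have := (μ i).cast_nonneg (α := ℝ)
  have := j.cast_nonneg (α := ℝ)
  split_ifs <;> linarith

theorem upperShift_zero_le (μ : Fin s → ℕ) (j : ℕ) (i : Fin s) :
    upperShift N μ 0 i ≤ upperShift N μ j i := by
  unfold upperShift
  have := j.cast_nonneg (α := ℝ)
  split_ifs <;> simp

theorem meijerKernel_weight (μ : Fin s → ℕ) (ν : Fin r → ℕ) (j : ℕ) :
    meijerKernel r s (weightUpper N μ j) (weightLower ν) =
      gammaKernel (upperShift N μ j) (fun i => (ν i : ℝ)) 1 := by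
  ext u
  have hr : ∀ i : Fin r, ¬r ≤ i.val := fun i => not_le.2 i.isLt
  have hs : ∀ i : Fin s, ¬s ≤ i.val := fun i => not_le.2 i.isLt
  simp only [meijerKernel, gammaKernel, Fin.is_lt, Finset.filter_true, hr, hs, Finset.filter_false,
    Finset.prod_empty, mul_one, div_one, eval_one, one_mul, weightLower, ofReal_natCast]
  congr 1
  refine Finset.prod_congr rfl fun i _ => congrArg Gamma ?_
  simp only [weightUpper, upperShift]
  split_ifs <;> push_cast <;> ring

/-- Written for `1 / Γ`, which is entire, the iterated functional equation holds at the poles of `Γ`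
as well. -/
theorem inv_Gamma_eq_ascPochhammer_mul (l : ℕ) (z : ℂ) :
    (Gamma z)⁻¹ = (ascPochhammer ℂ l).eval z * (Gamma (z + l))⁻¹ := by
  induction l with
  | zero => simp
  | succ l ih =>
    rw [ih, one_div_Gamma_eq_self_mul_one_div_Gamma_add_one, ascPochhammer_succ_eval]
    push_cast
    ring_nf

theorem Gamma_add_nat_of_re_pos (l : ℕ) {z : ℂ} (hz : 0 < z.re) :
    Gamma (z + l) = (ascPochhammer ℂ l).eval z * Gamma z := by
  have h := inv_Gamma_eq_ascPochhammer_mul l z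
  have h1 := Gamma_ne_zero_of_re_pos hz
  have h2 : Gamma (z + l) ≠ 0 := Gamma_ne_zero_of_re_pos (by
    simp only [add_re, natCast_re]
    positivity)
  field_simp at h
  rw [h]
  ring

/-- The extra parameters `ν_0 = 0` and `-l` contribute `Γ(-u) / Γ(-l-u) = (-l-u)_l`. In falling form
this is evaluated at `-1 - u`, which equals `k` at the moment point `u = -k - 1`. The condition on
`u` allows cancelling `Γ(-u)`. -/
theorem meijerKernel_dual (μ : Fin s → ℕ) (ν : Fin r → ℕ) (l : ℕ) {u : ℂ} (hu : u.re < 0) :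
    meijerKernel (r + 1) s (dualUpper N μ l) (dualLower ν) u =
      gammaKernel (upperShift N μ 0) (fun i => (ν i : ℝ)) ((descPochhammer ℂ l).comp (-1 - X))
        u := by
  have hr : ∀ i : Fin (r + 1), ¬r + 1 ≤ i.val := fun i => not_le.2 i.isLt
  have hs : ∀ i : Fin s, ¬s ≤ i.val := fun i => not_le.2 i.isLt
  have hG : Gamma (-u) ≠ 0 := Gamma_ne_zero_of_re_pos (by simpa using hu)
  have hinv := inv_Gamma_eq_ascPochhammer_mul l (-l - u)
  rw [show -(l : ℂ) - u + l = -u by ring] at hinv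
  have hν : ∏ i, Gamma (dualLower ν i - u) = Gamma (-u) * ∏ i, Gamma ((ν i : ℂ) - u) := by
    rw [Fin.prod_univ_succ]
    simp [dualLower, extendedNu]
  have hμ : ∏ i : Fin (s + 1) with i.val < s, Gamma (1 - dualUpper N μ l i + u) =
      ∏ i, Gamma (1 - -((μ i : ℂ) + N) + u) := by
    simp [Finset.prod_filter, Fin.prod_univ_castSucc, dualUpper]
  have hl : ∏ i : Fin (s + 1) with s ≤ i.val, Gamma (dualUpper N μ l i - u) =
      Gamma (-(l : ℂ) - u) := by
    simp [Finset.prod_filter, Fin.prod_univ_castSucc, dualUpper, hs]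
  simp only [meijerKernel, gammaKernel, hμ, hl, Fin.is_lt, Finset.filter_true, hν, hr,
    Finset.filter_false, Finset.prod_empty, one_mul, div_eq_mul_inv, hinv, ofReal_natCast,
    eval_comp, eval_sub, eval_neg, eval_one, eval_X]
  rw [descPochhammer_eval_eq_ascPochhammer, show -1 - u - l + 1 = -(l : ℂ) - u by ring]
  have hA : ∀ i : Fin s, (upperShift N μ 0 i : ℂ) + u = 1 - -((μ i : ℂ) + N) + u := fun i => by
    simp only [upperShift]
    split_ifs <;> push_cast <;> ring
  simp_rw [hA]
  field_simp

theorem gammaKernel_upperShift (hs : 1 ≤ s) (μ : Fin s → ℕ) (b : Fin r → ℝ) (j : ℕ) {u : ℂ}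
    (hu : ∀ i, -upperShift N μ 0 i < u.re) :
    gammaKernel (upperShift N μ j) b 1 u = gammaKernel (upperShift N μ 0) b
      ((ascPochhammer ℂ j).comp (X + C (upperShift N μ 0 ⟨0, hs⟩ : ℂ))) u := by
  simp only [gammaKernel, eval_one, one_mul, eval_comp, eval_add, eval_X, eval_C]
  have hi : (⟨0, hs⟩ : Fin s) ∈ Finset.univ := Finset.mem_univ _
  rw [← Finset.mul_prod_erase _ _ hi, ← Finset.mul_prod_erase _ _ hi]
  have h0 : (upperShift N μ j ⟨0, hs⟩ : ℂ) + u = upperShift N μ 0 ⟨0, hs⟩ + u + j := by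
    simp only [upperShift, if_true]
    push_cast
    ring
  have hrest : ∏ i ∈ Finset.univ.erase (⟨0, hs⟩ : Fin s), Gamma (upperShift N μ j i + u) =
      ∏ i ∈ Finset.univ.erase (⟨0, hs⟩ : Fin s), Gamma (upperShift N μ 0 i + u) := by
    refine Finset.prod_congr rfl fun i hi => ?_
    have : i.val ≠ 0 := fun h => (Finset.mem_erase.1 hi).1 (Fin.ext h)
    simp [upperShift, this]
  rw [hrest, h0, Gamma_add_nat_of_re_pos, add_comm u]
  · ring
  · have := hu ⟨0, hs⟩
    simp only [add_re, ofReal_re]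
    linarith

/-- `∏_j Γ(ν_j + k + 1) ∏_i Γ(μ_i + N - k)`. -/
noncomputable def momentConst (N : ℕ) (μ : Fin s → ℕ) (ν : Fin r → ℕ) (k : ℕ) : ℂ :=
  (∏ j, Gamma ((ν j : ℂ) + k + 1)) * ∏ i, Gamma ((μ i : ℂ) + N - k)

theorem Gamma_add_sub_ne_zero (m : ℕ) {k : ℕ} (hk : k < N) : Gamma ((m : ℂ) + N - k) ≠ 0 := by
  refine Gamma_ne_zero_of_re_pos ?_
  have : (k : ℝ) < N := by exact_mod_cast hk
  have := m.cast_nonneg (α := ℝ)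
  simp only [sub_re, add_re, natCast_re]
  linarith

theorem Gamma_natCast_add_one_ne_zero (m k : ℕ) : Gamma ((m : ℂ) + k + 1) ≠ 0 := by
  refine Gamma_ne_zero_of_re_pos ?_
  simp only [add_re, natCast_re, one_re]
  positivity

theorem momentConst_ne_zero (μ : Fin s → ℕ) (ν : Fin r → ℕ) {k : ℕ} (hk : k < N) :
    momentConst N μ ν k ≠ 0 :=
  mul_ne_zero (Finset.prod_ne_zero_iff.2 fun j _ => Gamma_natCast_add_one_ne_zero (ν j) k)
    (Finset.prod_ne_zero_iff.2 fun i _ => Gamma_add_sub_ne_zero (μ i) hk)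

theorem gammaKernel_neg_nat_sub_one (μ : Fin s → ℕ) (ν : Fin r → ℕ) (p : ℂ[X]) (k : ℕ) :
    gammaKernel (upperShift N μ 0) (fun i => (ν i : ℝ)) p (-(k : ℂ) - 1) =
      p.eval (-(k : ℂ) - 1) * momentConst N μ ν k := by
  simp only [gammaKernel, momentConst]
  congr 2
  · refine Finset.prod_congr rfl fun i _ => congrArg Gamma ?_
    push_cast
    ring
  · refine Finset.prod_congr rfl fun i _ => congrArg Gamma ?_
    simp only [upperShift]
    split_ifs <;> push_cast <;> ring

theorem neg_one_pow_div_constC (μ : Fin s → ℕ) (ν : Fin r → ℕ) (l : ℕ) :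
    (-1) ^ l / constC N μ ν l = ((l.factorial : ℂ) * momentConst N μ ν l)⁻¹ := by
  have h : constC N μ ν l = (-1) ^ l * ((l.factorial : ℂ) * momentConst N μ ν l) := by
    rw [constC, momentConst, Fin.prod_univ_succ]
    simp only [extendedNu, Fin.cons_zero, Fin.cons_succ, Nat.cast_zero, zero_add,
      Gamma_nat_eq_factorial]
    ring
  rw [h, div_mul_eq_div_div, div_self (pow_ne_zero _ (by norm_num)), one_div]

theorem separatesPoles_weight_iff (μ : Fin s → ℕ) (ν : Fin r → ℕ) (j : ℕ) (c : ℝ) :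
    SeparatesPoles c r s (weightUpper N μ j) (weightLower ν) ↔
      (∀ i, -upperShift N μ j i < c) ∧ ∀ i, c < ν i := by
  rw [SeparatesPoles, and_comm]
  refine and_congr (forall_congr' fun i => ?_) (forall_congr' fun i => ?_)
  · simp only [Fin.is_lt, true_imp_iff, weightUpper, upperShift]
    split_ifs <;> simp <;> constructor <;> intro h <;> linarith
  · simp [weightLower]

theorem SeparatesPoles.of_dual {μ : Fin s → ℕ} {ν : Fin r → ℕ} {l : ℕ} {c : ℝ}
    (h : SeparatesPoles c (r + 1) s (dualUpper N μ l) (dualLower ν)) :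
    c < 0 ∧ ∀ i, -upperShift N μ 0 i < c := by
  constructor
  · simpa [dualLower, extendedNu] using h.1 0 (by simp)
  · intro i
    have := h.2 i.castSucc i.isLt
    simp only [dualUpper, Fin.snoc_castSucc, neg_re, add_re, natCast_re] at this
    simp only [upperShift]
    split_ifs <;> push_cast <;> linarith

theorem weightFun_eq (μ : Fin s → ℕ) (ν : Fin r → ℕ) (c : ℝ) (j : ℕ) (x : ℝ) :
    weightFun N μ ν c j x =
      lineTransform (gammaKernel (upperShift N μ j) (fun i => (ν i : ℝ)) 1) c x := by
  rw [weightFun, meijerG, meijerKernel_weight]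
  rfl

theorem dualFun_eq (μ : Fin s → ℕ) (ν : Fin r → ℕ) {c : ℝ} (hc : c < 0) (l : ℕ) (x : ℝ) :
    dualFun N μ ν c l x = ((l.factorial : ℂ) * momentConst N μ ν l)⁻¹ *
      lineTransform (gammaKernel (upperShift N μ 0) (fun i => (ν i : ℝ))
        ((descPochhammer ℂ l).comp (-1 - X))) c x := by
  rw [dualFun, neg_one_pow_div_constC, meijerG, lineTransform]
  congr 3
  ext t
  rw [meijerKernel_dual μ ν l (by simpa using hc)]

/-- `P_n` in powers of `x`. -/
theorem polyFun_eq (μ : Fin s → ℕ) (ν : Fin r → ℕ) {n : ℕ} (hn : n < N) (x : ℝ) :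
    polyFun N μ ν n x = ∑ k ∈ Finset.range (n + 1),
      ((-1) ^ (n + k) * (n.choose k : ℂ) * momentConst N μ ν n / momentConst N μ ν k) *
        (x : ℂ) ^ k := by
  -- A reflected Pochhammer identity; `k < N` keeps `m + N - k` positive, away from the poles.
  have hasc : ∀ (m : ℕ) {k : ℕ}, k < N →
      (ascPochhammer ℂ k).eval (1 - (m : ℂ) - N) * Gamma ((m : ℂ) + N - k) =
        (-1) ^ k * Gamma ((m : ℂ) + N) := by
    intro m k hk
    induction k with
    | zero => simp
    | succ k ih =>
      rw [ascPochhammer_succ_eval, pow_succ]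
      have h1 : Gamma ((m : ℂ) + N - k) =
          ((m : ℂ) + N - (k + 1 : ℕ)) * Gamma ((m : ℂ) + N - (k + 1 : ℕ)) := by
        rw [← Gamma_add_one]
        · congr 1
          push_cast
          ring
        · intro h
          have := Gamma_add_sub_ne_zero m hk
          rw [h, Gamma_zero] at this
          exact this rfl
      have h2 := ih (by omega)
      rw [h1] at h2
      push_cast at h2 ⊢
      linear_combination -h2
  have hasc' : ∀ m k : ℕ, (ascPochhammer ℂ k).eval (1 + (m : ℂ)) * Gamma ((m : ℂ) + 1) =
      Gamma ((m : ℂ) + k + 1) := by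
    intro m k
    rw [add_comm 1 (m : ℂ), ← Gamma_add_nat_of_re_pos]
    · ring_nf
    · simp only [add_re, natCast_re, one_re]
      positivity
  rw [polyFun, hypergeomPFQ, tsum_eq_sum (s := Finset.range (n + 1)), Finset.mul_sum]
  · refine Finset.sum_congr rfl fun k hk => ?_
    have hkn : k ≤ n := Nat.lt_succ_iff.1 (Finset.mem_range.1 hk)
    have hkN : k < N := hkn.trans_lt hn
    rw [Fin.prod_univ_succ]
    simp only [Fin.cons_zero, Fin.cons_succ]
    have e1 : (ascPochhammer ℂ k).eval (-(n : ℂ)) = (-1) ^ k * (n.choose k * k.factorial : ℂ) := by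
      rw [ascPochhammer_eval_neg_eq_descPochhammer, descPochhammer_eval_eq_descFactorial,
        Nat.descFactorial_eq_factorial_mul_choose]
      push_cast
      ring
    have e2 : ∏ i, (ascPochhammer ℂ k).eval (1 - (μ i : ℂ) - N) =
        (-1) ^ (s * k) * ((∏ i, Gamma ((μ i : ℂ) + N)) / ∏ i, Gamma ((μ i : ℂ) + N - k)) := by
      rw [← Finset.prod_div_distrib, pow_mul', ← Fin.prod_const, ← Finset.prod_mul_distrib]
      refine Finset.prod_congr rfl fun i _ => ?_
      rw [← mul_div_assoc, eq_div_iff (Gamma_add_sub_ne_zero (μ i) hkN), hasc (μ i) hkN]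
    have e3 : ∏ i, (ascPochhammer ℂ k).eval (1 + (ν i : ℂ)) =
        (∏ i, Gamma ((ν i : ℂ) + k + 1)) / ∏ i, Gamma ((ν i : ℂ) + 1) := by
      rw [← Finset.prod_div_distrib]
      refine Finset.prod_congr rfl fun i _ => ?_
      have := Gamma_natCast_add_one_ne_zero (ν i) 0
      rw [eq_div_iff (by simpa using this), hasc']
    have n1 : ∏ i, Gamma ((ν i : ℂ) + k + 1) ≠ 0 :=
      Finset.prod_ne_zero_iff.2 fun i _ => Gamma_natCast_add_one_ne_zero (ν i) k
    have n2 : ∏ i, Gamma ((ν i : ℂ) + 1) ≠ 0 :=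
      Finset.prod_ne_zero_iff.2 fun i _ => by
        simpa using Gamma_natCast_add_one_ne_zero (ν i) 0
    have n3 : ∏ i, Gamma ((μ i : ℂ) + N) ≠ 0 :=
      Finset.prod_ne_zero_iff.2 fun i _ => by
        simpa using Gamma_add_sub_ne_zero (μ i) (show 0 < N by omega)
    have n4 : ∏ i, Gamma ((μ i : ℂ) + N - k) ≠ 0 :=
      Finset.prod_ne_zero_iff.2 fun i _ => Gamma_add_sub_ne_zero (μ i) hkN
    have n5 : (k.factorial : ℂ) ≠ 0 := by exact_mod_cast k.factorial_ne_zero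
    -- The signs of the `s` reflected Pochhammer symbols cancel against the argument `(-1)^s x`.
    have n6 : ((-1 : ℂ) ^ (s * k)) * (-1) ^ (s * k) = 1 := by
      rw [← mul_pow]
      simp
    rw [e1, e2, e3, mul_pow, ← pow_mul, Finset.prod_div_distrib, Finset.prod_div_distrib,
      momentConst, momentConst, pow_add]
    field_simp
    linear_combination ((∏ i, Gamma ((ν i : ℂ) + n + 1)) * (∏ i, Gamma ((μ i : ℂ) + N - n)) *
      (n.choose k : ℂ) * (x : ℂ) ^ k) * n6
  -- The factor `(-n)_k` vanishes for `k > n`, so the series terminates.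
  · intro k hk
    have hkn : n < k := by simpa [Nat.lt_succ_iff] using hk
    rw [Fin.prod_univ_succ]
    simp only [Fin.cons_zero]
    rw [ascPochhammer_eval_neg_coe_nat_of_lt hkn, zero_mul, zero_div, zero_mul]

end ProductEnsemble

/-! ### Biorthogonality and spans for the product ensemble. -/

section ProductEnsemble

open Complex Set MeasureTheory Polynomial

theorem exists_eq_sum_of_monic {q : ℕ → ℂ[X]} (hq : ∀ j, (q j).Monic)
    (hdeg : ∀ j, (q j).natDegree = j) (l : ℕ) (p : ℂ[X]) (hp : p.natDegree ≤ l) :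
    ∃ d : ℕ → ℂ, p = ∑ j ∈ Finset.range (l + 1), C (d j) * q j := by
  induction l generalizing p with
  | zero =>
    refine ⟨fun _ => p.coeff 0, ?_⟩
    have h0 : q 0 = 1 := (hq 0).natDegree_eq_zero.1 (hdeg 0)
    simpa [h0] using eq_C_of_natDegree_le_zero hp
  | succ l ih =>
    obtain ⟨d, hd⟩ := ih (p - C (p.coeff (l + 1)) * q (l + 1)) (by
      refine natDegree_le_iff_coeff_eq_zero.2 fun m hm => ?_
      rw [coeff_sub, coeff_C_mul]
      rcases eq_or_lt_of_le (Nat.succ_le_of_lt hm) with h | h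
      · have := (hq (l + 1)).coeff_natDegree
        rw [hdeg] at this
        rw [← h, Nat.succ_eq_add_one, this, mul_one, sub_self]
      · rw [coeff_eq_zero_of_natDegree_lt (hp.trans_lt h),
          coeff_eq_zero_of_natDegree_lt (p := q (l + 1)) (by rw [hdeg]; exact h), mul_zero,
          sub_zero])
    refine ⟨fun j => if j ≤ l then d j else p.coeff (l + 1), ?_⟩
    rw [Finset.sum_range_succ, ← sub_eq_iff_eq_add]
    dsimp only
    rw [if_neg (Nat.not_succ_le_self l), hd]
    refine Finset.sum_congr rfl fun j hj => ?_
    rw [if_pos (Nat.lt_succ_iff.1 (Finset.mem_range.1 hj))]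

/-- The `n`-th finite difference at `0` of a falling factorial. For `l ≤ n`, factoring out `l! (n
choose l)` leaves the alternating sum of the binomials `(n-l choose k-l)`, that is `(1-1)^(n-l)`. -/
theorem sum_alternating_choose_mul_descFactorial (n l : ℕ) :
    ∑ k ∈ Finset.range (n + 1), (-1 : ℂ) ^ (n + k) * (n.choose k * k.descFactorial l) =
      if n = l then (n.factorial : ℂ) else 0 := by
  rcases lt_or_ge n l with h | h
  · rw [if_neg h.ne]
    refine Finset.sum_eq_zero fun k hk => ?_
    rw [Nat.descFactorial_eq_zero_iff_lt.2 (by have := Finset.mem_range.1 hk; omega)]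
    simp
  · obtain ⟨m, rfl⟩ := Nat.exists_eq_add_of_le h
    rw [add_assoc, Finset.sum_range_add, Finset.sum_eq_zero, zero_add]
    · have hterm : ∀ k ∈ Finset.range (m + 1), (-1 : ℂ) ^ (l + m + (l + k)) *
          ((l + m).choose (l + k) * (l + k).descFactorial l) =
          ((-1) ^ m * (l.factorial * (l + m).choose l : ℂ)) * (((-1) ^ k * m.choose k : ℤ) : ℂ) := by
        intro k hk
        have hc := Nat.choose_mul (n := l + m) (k := l + k) (s := l) (by omega)
        rw [Nat.add_sub_cancel_left, Nat.add_sub_cancel_left] at hc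
        have hc' : ((l + m).choose (l + k) : ℂ) * (l + k).choose l = (l + m).choose l * m.choose k := by
          exact_mod_cast hc
        rw [Nat.descFactorial_eq_factorial_mul_choose,
          show l + m + (l + k) = 2 * l + m + k by ring, pow_add, pow_add, pow_mul]
        push_cast
        rw [neg_one_sq, one_pow]
        linear_combination ((-1) ^ m * (-1) ^ k * (l.factorial : ℂ)) * hc'
      rw [Finset.sum_congr rfl hterm, ← Finset.mul_sum, ← Int.cast_sum,
        Int.alternating_sum_range_choose]
      by_cases hm : m = 0
      · subst hm
        simp
      · simp [hm]
    · intro k hk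
      rw [Nat.descFactorial_eq_zero_iff_lt.2 (Finset.mem_range.1 hk)]
      simp

theorem exists_monic_eval_eq_polyFun {N r s : ℕ} (μ : Fin s → ℕ) (ν : Fin r → ℕ) {n : ℕ}
    (hn : n < N) :
    ∃ p : ℂ[X], p.Monic ∧ p.natDegree = n ∧ ∀ x : ℝ, polyFun N μ ν n x = p.eval (x : ℂ) := by
  have hlt : (∑ k ∈ Finset.range n, C ((-1) ^ (n + k) * (n.choose k : ℂ) * momentConst N μ ν n /
      momentConst N μ ν k) * X ^ k).degree < (n : WithBot ℕ) := by
    rw [degree_lt_iff_coeff_zero]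
    intro m hm
    rw [finsetSum_coeff]
    refine Finset.sum_eq_zero fun k hk => ?_
    rw [coeff_C_mul_X_pow, if_neg]
    have := Finset.mem_range.1 hk
    omega
  refine ⟨X ^ n + _, monic_X_pow_add hlt, ?_, fun x => ?_⟩
  · rw [natDegree_add_eq_left_of_degree_lt (by rwa [degree_X_pow]), natDegree_X_pow]
  rw [polyFun_eq μ ν hn, Finset.sum_range_succ, add_comm]
  have h1 : (-1 : ℂ) ^ (n + n) = 1 := by rw [← two_mul, pow_mul, neg_one_sq, one_pow]
  rw [h1, Nat.choose_self, Nat.cast_one, mul_one, one_mul, div_self (momentConst_ne_zero μ ν hn),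
    one_mul]
  simp [eval_finsetSum]

section Moments

variable {N r s : ℕ} {μ : Fin s → ℕ} {ν : Fin r → ℕ} {c : ℝ}

theorem natCast_add_two_le_upperShift {k : ℕ} (hk : k < N) (j : ℕ) (i : Fin s) :
    (k : ℝ) + 2 ≤ upperShift N μ j i := by
  have h1 := one_add_le_upperShift (N := N) μ j i
  have h2 : (k : ℝ) + 1 ≤ N := by exact_mod_cast hk
  linarith

theorem integrableOn_pow_mul_weightFun (hs : 1 ≤ s) {j : ℕ}
    (h : SeparatesPoles c r s (weightUpper N μ j) (weightLower ν)) {k : ℕ} (hk : k < N) :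
    IntegrableOn (fun x : ℝ => (x : ℂ) ^ k * weightFun N μ ν c j x) (Ioi 0) := by
  have : Nonempty (Fin s) := ⟨⟨0, hs⟩⟩
  obtain ⟨ha, hb⟩ := (separatesPoles_weight_iff μ ν j c).1 h
  simp_rw [weightFun_eq]
  exact (moment_gammaKernel _ _ 1 ha hb (natCast_add_two_le_upperShift hk j)
    fun i => (ν i).cast_nonneg).1

theorem moment_dualFun (hs : 1 ≤ s) {l : ℕ}
    (h : SeparatesPoles c (r + 1) s (dualUpper N μ l) (dualLower ν)) {k : ℕ} (hk : k < N) :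
    IntegrableOn (fun x : ℝ => (x : ℂ) ^ k * dualFun N μ ν c l x) (Ioi 0) ∧
      ∫ x in Ioi (0 : ℝ), (x : ℂ) ^ k * dualFun N μ ν c l x =
        ((l.factorial : ℂ) * momentConst N μ ν l)⁻¹ *
          (k.descFactorial l * momentConst N μ ν k) := by
  have : Nonempty (Fin s) := ⟨⟨0, hs⟩⟩
  obtain ⟨hc, ha⟩ := h.of_dual
  obtain ⟨h1, h2⟩ := moment_gammaKernel (upperShift N μ 0) (fun i => (ν i : ℝ))
    ((descPochhammer ℂ l).comp (-1 - X)) ha (fun i => hc.trans_le (ν i).cast_nonneg)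
    (natCast_add_two_le_upperShift hk 0) fun i => (ν i).cast_nonneg
  simp_rw [dualFun_eq μ ν hc, mul_left_comm _ ((_ : ℂ)⁻¹)]
  refine ⟨h1.const_mul _, ?_⟩
  rw [integral_const_mul, h2, gammaKernel_neg_nat_sub_one, eval_comp, eval_sub, eval_neg, eval_one,
    eval_X, show (-1 : ℂ) - (-(k : ℂ) - 1) = k by ring, descPochhammer_eval_eq_descFactorial]

theorem integral_polyFun_mul_dualFun (hs : 1 ≤ s) {l n : ℕ} (hn : n < N) (hl : l < N)
    (h : SeparatesPoles c (r + 1) s (dualUpper N μ l) (dualLower ν)) :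
    IntegrableOn (fun x : ℝ => polyFun N μ ν n x * dualFun N μ ν c l x) (Ioi 0) ∧
      ∫ x in Ioi (0 : ℝ), polyFun N μ ν n x * dualFun N μ ν c l x = if n = l then 1 else 0 := by
  have hkN : ∀ k ∈ Finset.range (n + 1), k < N := fun k hk => by
    have := Finset.mem_range.1 hk
    omega
  simp_rw [polyFun_eq μ ν hn, Finset.sum_mul, mul_assoc (_ / _)]
  have hint : ∀ k ∈ Finset.range (n + 1), IntegrableOn (fun x : ℝ =>
      ((-1) ^ (n + k) * (n.choose k : ℂ) * momentConst N μ ν n / momentConst N μ ν k) *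
        ((x : ℂ) ^ k * dualFun N μ ν c l x)) (Ioi 0) := fun k hk =>
    (moment_dualFun hs h (hkN k hk)).1.const_mul _
  refine ⟨integrable_finsetSum _ hint, ?_⟩
  have hl0 : (l.factorial : ℂ) ≠ 0 := by exact_mod_cast l.factorial_ne_zero
  have hml := momentConst_ne_zero μ ν hl
  have hterm : ∀ k ∈ Finset.range (n + 1), ∫ x in Ioi (0 : ℝ),
      ((-1) ^ (n + k) * (n.choose k : ℂ) * momentConst N μ ν n / momentConst N μ ν k) *
        ((x : ℂ) ^ k * dualFun N μ ν c l x) =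
      (momentConst N μ ν n / (l.factorial * momentConst N μ ν l)) *
        ((-1 : ℂ) ^ (n + k) * (n.choose k * k.descFactorial l)) := fun k hk => by
    have hmk := momentConst_ne_zero μ ν (hkN k hk)
    rw [integral_const_mul, (moment_dualFun hs h (hkN k hk)).2]
    field_simp
  rw [integral_finsetSum _ hint, Finset.sum_congr rfl hterm, ← Finset.mul_sum,
    sum_alternating_choose_mul_descFactorial]
  split_ifs with hnl
  · subst hnl
    field_simp
  · rw [mul_zero]

/-- The weight functions may come with different contours; all are moved to one line admissible for
the dual function, where they share the same Gamma product and differ only by polynomials. -/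
theorem weightFun_eq_lineTransform (hs : 1 ≤ s) {j : ℕ} {c' : ℝ}
    (h : SeparatesPoles c' r s (weightUpper N μ j) (weightLower ν)) (hc : c < 0)
    (ha : ∀ i, -upperShift N μ 0 i < c) {x : ℝ} (hx : 0 < x) :
    weightFun N μ ν c' j x =
      lineTransform (gammaKernel (upperShift N μ 0) (fun i => (ν i : ℝ))
        ((ascPochhammer ℂ j).comp (X + C (upperShift N μ 0 ⟨0, hs⟩ : ℂ)))) c x := by
  have : Nonempty (Fin s) := ⟨⟨0, hs⟩⟩
  obtain ⟨ha', hb'⟩ := (separatesPoles_weight_iff μ ν j c').1 h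
  rw [weightFun_eq, lineTransform_gammaKernel_congr _ _ 1 ha' hb'
    (fun i => lt_of_le_of_lt (neg_le_neg (upperShift_zero_le μ j i)) (ha i))
    (fun i => hc.trans_le (ν i).cast_nonneg) hx, lineTransform, lineTransform]
  congr 2
  ext t
  rw [gammaKernel_upperShift hs μ _ j fun i => by simpa using ha i]

theorem exists_dualFun_eq_sum (hs : 1 ≤ s) {cI : Fin N → ℝ}
    (hcI : ∀ j : Fin N, SeparatesPoles (cI j) r s (weightUpper N μ j) (weightLower ν)) (l : Fin N)
    (h : SeparatesPoles c (r + 1) s (dualUpper N μ l) (dualLower ν)) :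
    ∃ d : Fin N → ℂ, ∀ x : ℝ, 0 < x →
      dualFun N μ ν c l x = ∑ j ∈ Finset.Iic l, d j * weightFun N μ ν (cI j) j x := by
  have : Nonempty (Fin s) := ⟨⟨0, hs⟩⟩
  obtain ⟨hc, ha⟩ := h.of_dual
  obtain ⟨d, hd⟩ := exists_eq_sum_of_monic
    (q := fun j => (ascPochhammer ℂ j).comp (X + C (upperShift N μ 0 ⟨0, hs⟩ : ℂ)))
    (fun j => (monic_ascPochhammer ℂ j).comp_X_add_C _)
    (fun j => by rw [natDegree_comp, natDegree_X_add_C, mul_one, ascPochhammer_natDegree]) l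
    ((descPochhammer ℂ l).comp (-1 - X)) (by
      refine natDegree_comp_le.trans ?_
      rw [descPochhammer_natDegree]
      have : (-1 - X : ℂ[X]).natDegree ≤ 1 := by
        refine (natDegree_sub_le _ _).trans ?_
        simp
      exact (Nat.mul_le_mul_left _ this).trans (mul_one _).le)
  refine ⟨fun j => ((l.val.factorial : ℂ) * momentConst N μ ν l)⁻¹ * d j, fun x hx => ?_⟩
  rw [dualFun_eq μ ν hc, hd, lineTransform_gammaKernel_sum _ _ _ _ _ ha
    (fun i => hc.trans_le (ν i).cast_nonneg) hx, Finset.mul_sum]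
  symm
  refine Finset.sum_bij (fun j _ => j.val) (fun j hj => ?_) (fun i _ j _ hij => Fin.ext hij)
    (fun j hj => ?_) (fun j hj => ?_)
  · exact Finset.mem_range.2 (Nat.lt_succ_iff.2 (Fin.le_def.1 (Finset.mem_Iic.1 hj)))
  · have hjl := Nat.lt_succ_iff.1 (Finset.mem_range.1 hj)
    exact ⟨⟨j, hjl.trans_lt l.isLt⟩, Finset.mem_Iic.2 hjl, rfl⟩
  · rw [weightFun_eq_lineTransform hs (hcI j) hc ha hx, mul_assoc]

end Moments

end ProductEnsemble

theorem proposition4 (r s N : ℕ) (hs : 1 ≤ s) (μ : Fin s → ℕ) (ν : Fin r → ℕ)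
    (cI cQ : Fin N → ℝ)
    (hcI : ∀ j : Fin N, SeparatesPoles (cI j) r s (weightUpper N μ j) (weightLower ν))
    (hcQ : ∀ l : Fin N, SeparatesPoles (cQ l) (r + 1) s (dualUpper N μ l) (dualLower ν)) :
    let φ : Fin N → ℝ → ℂ := fun j => weightFun N μ ν (cI j) j
    let P : Fin N → ℝ → ℂ := fun n => polyFun N μ ν n
    let Q : Fin N → ℝ → ℂ := fun l => dualFun N μ ν (cQ l) l
    -- the contour integrals converge absolutely
    (∀ j : Fin N, Complex.VerticalIntegrable
      (meijerKernel r s (weightUpper N μ j) (weightLower ν)) (cI j)) ∧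
    (∀ l : Fin N, Complex.VerticalIntegrable
      (meijerKernel (r + 1) s (dualUpper N μ l) (dualLower ν)) (cQ l)) ∧
    -- `P`, `Q` is the biorthogonal system of the ensemble
    IsBiorthogonalSystem φ P Q ∧
    (∀ P' Q' : Fin N → ℝ → ℂ, IsBiorthogonalSystem φ P' Q' →
      ∀ n : Fin N, (∀ x : ℝ, P' n x = P n x) ∧ (∀ x : ℝ, 0 < x → Q' n x = Q n x)) ∧
    -- the weight can be normalized, and `K_N` is the correlation kernel of the ensemble
    MeasureTheory.IntegrableOn (ensembleWeight φ) (posOrthant N) ∧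
    (∫ x in posOrthant N, ensembleWeight φ x) ≠ 0 ∧
    (∀ k : ℕ, k ≤ N → ∀ x : Fin k → ℝ, (∀ i, 0 < x i) →
      correlationFunction (ensembleWeight φ) k x =
        (Matrix.of fun i j : Fin k => biorthogonalKernel P Q (x i) (x j)).det) := by
  intro φ P Q
  have : Nonempty (Fin s) := ⟨⟨0, hs⟩⟩
  have hsys : IsBiorthogonalSystem φ P Q :=
    { monic := fun n => exists_monic_eval_eq_polyFun μ ν n.isLt
      span := fun l => exists_dualFun_eq_sum hs hcI l (hcQ l)
      integrable := fun n l => (integral_polyFun_mul_dualFun hs n.isLt l.isLt (hcQ l)).1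
      biorthogonal := fun n l => by
        rw [(integral_polyFun_mul_dualFun hs n.isLt l.isLt (hcQ l)).2]
        simp only [Fin.ext_iff] }
  have hint : ∀ k j : Fin N, MeasureTheory.IntegrableOn
      (fun x : ℝ => (x : ℂ) ^ (k : ℕ) * φ j x) (Set.Ioi 0) := fun k j =>
    integrableOn_pow_mul_weightFun hs (hcI j) k.isLt
  refine ⟨fun j => ?_, fun l => ?_, hsys, fun P' Q' h' n => hsys.unique hint h' n,
    hsys.integrableOn_ensembleWeight hint⟩
  · obtain ⟨ha, hb⟩ := (separatesPoles_weight_iff μ ν j (cI j)).1 (hcI j)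
    rw [meijerKernel_weight]
    exact (stripDecay_gammaKernel _ _ 1 ha hb).integrable_line ⟨le_rfl, le_rfl⟩
  · obtain ⟨hc, ha⟩ := (hcQ l).of_dual
    refine ((stripDecay_gammaKernel (upperShift N μ 0) (fun i => (ν i : ℝ))
      ((descPochhammer ℂ l).comp (-1 - Polynomial.X)) ha
      fun i => hc.trans_le (ν i).cast_nonneg).integrable_line ⟨le_rfl, le_rfl⟩).congr
      (MeasureTheory.ae_of_all _ fun t => ?_)
    exact (meijerKernel_dual μ ν l (by simpa using hc)).symm
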